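/- A system is a weighted system $Az=b$ of $m$ linear equations in $n$ variables over $\mathbb{F}_2$ in which every equation contains at least one variable and has a positive integer weight. The excess of an assignment $z\in\mathbb{F}_2^n$ is the total weight of the equations it satisfies minus the total weight of the equations it falsifies. Max Lin AA is the following parameterized problem: given a system $Az=b$ and the parameter $k\in\mathbb{N}$, decide whether the maximum excess over all assignments is at least $k$. **Proposition.** Max Lin AA can be solved in time $O(m^{k+O(1)})$. Precisely: there are a program $P$ for the random access machine (registers and memory cells hold natural numbers; addition, truncated subtraction, halving, copying, indirect memory access and tests for zero cost one step each) and constants $C,c\in\mathbb{N}$ such that for all $n,m,k\in\mathbb{N}$ and every system of $m$ equations in $n$ variables, given to the machine as the sequence of the numbers $k,n,m$ and, for every equation, its coefficients, right-hand side and weight, $P$ halts with the correct answer; if $m\ge 1$, it does so after at most $C\,n^{c}m^{k+c}$ steps, and if moreover $n\le m$ (in particular, if $n=\operatorname{rank}A$), after at most $C\,m^{k+c}$ steps. Consequently Max Lin AA is in XP: with systems encoded as binary strings $x$ (the weights in binary), it can be decided whether $(x,k)$ is a yes-instance in time $|x|^{O(f(k))}$ for some computable function $f$. -/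

import Mathlib

namespace MaxLin

/-! ### Weighted linear systems over the field with two elements -/

/-- A weighted system `A z = b` of `m` linear equations in `n` variables over `𝔽₂`. The weights are
positive integers, and every equation contains at least one variable. -/
structure System (n m : ℕ) where
  /-- the coefficient matrix -/
  A : Matrix (Fin m) (Fin n) (ZMod 2)
  /-- the right-hand sides -/
  b : Fin m → ZMod 2
  /-- the weights of the equations -/
  w : Fin m → ℕ
  w_pos : ∀ j, 0 < w j
  row_ne_zero : ∀ j, ∃ i, A j i ≠ 0

namespace System

variable {n m : ℕ}

/-- The excess of an assignment: the total weight of the satisfied equations minus the total weight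
of the falsified ones. -/
def excess (S : System n m) (z : Fin n → ZMod 2) : ℤ :=
  (∑ j with S.A.mulVec z j = S.b j, (S.w j : ℤ)) - ∑ j with S.A.mulVec z j ≠ S.b j, (S.w j : ℤ)

/-- The maximum excess over all assignments. -/
def maxExcess (S : System n m) : ℤ :=
  Finset.univ.sup' Finset.univ_nonempty S.excess

/-- The system as a sequence of natural numbers: `n`, `m`, and then for every equation its `n`
coefficients, its right-hand side and its weight. -/
def toWords (S : System n m) : List ℕ :=
  [n, m] ++ (List.ofFn fun j =>
    (List.ofFn fun i => (S.A j i).val) ++ [(S.b j).val, S.w j]).flatten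

/-- The system as a bit string: `n` and `m` in unary (each closed by a `0`), and then for every
equation its `n` coefficients, its right-hand side and its weight in binary. A weight is written with
its least significant digit first, a `1` before every digit and a closing `0`. -/
def toBits (S : System n m) : List Bool :=
  List.replicate n true ++ [false] ++ (List.replicate m true ++ [false]) ++
    (List.ofFn fun j =>
      (List.ofFn fun i => decide (S.A j i = 1)) ++ [decide (S.b j = 1)] ++
        ((S.w j).bits.flatMap fun d => [true, d]) ++ [false]).flatten

end System

/-! ### Random access machines with uniform cost -/

/-- A configuration: registers and memory cells, each of them holding a natural number. (A program
mentions only finitely many registers; the memory is addressed indirectly.) -/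
structure State where
  reg : ℕ → ℕ
  mem : ℕ → ℕ

/-- Elementary instructions. There is no multiplication, so that a run of `t` steps lengthens
the binary expansions of the numbers involved by at most `t` digits (up to constants). -/
inductive Instr where
  /-- `r_d := c` -/
  | const (d c : ℕ)
  /-- `r_d := r_a` -/
  | copy (d a : ℕ)
  /-- `r_d := r_a + r_b` -/
  | add (d a b : ℕ)
  /-- `r_d := max (r_a - r_b) 0` -/
  | sub (d a b : ℕ)
  /-- `r_d := ⌊r_a / 2⌋` -/
  | half (d a : ℕ)
  /-- `r_d := mem[r_a]` -/
  | load (d a : ℕ)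
  /-- `mem[r_a] := r_b` -/
  | store (a b : ℕ)

/-- The effect of an elementary instruction. -/
def Instr.apply : Instr → State → State
  | .const d c, s => { s with reg := Function.update s.reg d c }
  | .copy d a, s => { s with reg := Function.update s.reg d (s.reg a) }
  | .add d a b, s => { s with reg := Function.update s.reg d (s.reg a + s.reg b) }
  | .sub d a b, s => { s with reg := Function.update s.reg d (s.reg a - s.reg b) }
  | .half d a, s => { s with reg := Function.update s.reg d (s.reg a / 2) }
  | .load d a, s => { s with reg := Function.update s.reg d (s.mem (s.reg a)) }
  | .store a b, s => { s with mem := Function.update s.mem (s.reg a) (s.reg b) }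

/-- Programs: elementary instructions, composition, branching on `0 < r_a`, and loops that run as
long as `0 < r_a`. -/
inductive Prog where
  | instr (i : Instr)
  | seq (P Q : Prog)
  | ifPos (a : ℕ) (P Q : Prog)
  | whilePos (a : ℕ) (P : Prog)

/-- `Exec P s t s'`: started in the configuration `s`, the program `P` halts after exactly `t` steps
in the configuration `s'`. Every elementary instruction and every test is one step. -/
inductive Exec : Prog → State → ℕ → State → Prop where
  | instr (i : Instr) (s : State) : Exec (.instr i) s 1 (i.apply s)
  | seq {P Q : Prog} {s₁ s₂ s₃ : State} {t u : ℕ} :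
      Exec P s₁ t s₂ → Exec Q s₂ u s₃ → Exec (.seq P Q) s₁ (t + u) s₃
  | ifTrue {a : ℕ} {P Q : Prog} {s s' : State} {t : ℕ} :
      0 < s.reg a → Exec P s t s' → Exec (.ifPos a P Q) s (t + 1) s'
  | ifFalse {a : ℕ} {P Q : Prog} {s s' : State} {t : ℕ} :
      s.reg a = 0 → Exec Q s t s' → Exec (.ifPos a P Q) s (t + 1) s'
  | whileTrue {a : ℕ} {P : Prog} {s₁ s₂ s₃ : State} {t u : ℕ} :
      0 < s₁.reg a → Exec P s₁ t s₂ → Exec (.whilePos a P) s₂ u s₃ →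
        Exec (.whilePos a P) s₁ (t + u + 1) s₃
  | whileFalse {a : ℕ} {P : Prog} {s : State} :
      s.reg a = 0 → Exec (.whilePos a P) s 1 s

/-- The initial configuration: the input is in the memory cells `0, 1, 2, …`, its length is in
register `0`, and everything else is `0`. -/
def State.start (x : List ℕ) : State where
  reg r := if r = 0 then x.length else 0
  mem i := x.getD i 0

/-- On input `x` the program `P` halts after exactly `t` steps and answers the yes/no question `q`
correctly; the answer "yes" is given by a positive number in register `0`. -/
def Prog.Answers (P : Prog) (x : List ℕ) (t : ℕ) (q : Prop) : Prop :=
  ∃ s, Exec P (State.start x) t s ∧ (0 < s.reg 0 ↔ q)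

/-! ### Parameterized problems -/

/-- The class XP: membership of `(x, k)` can be decided in time `|x| ^ O(f k)` for a
computable function `f`. (The `+ 2` only matters for `|x| ≤ 1`.) -/
def InXP (L : Set (List Bool × ℕ)) : Prop :=
  ∃ (P : Prog) (f : ℕ → ℕ), Computable f ∧ ∀ (x : List Bool) (k : ℕ), ∃ t : ℕ,
    P.Answers (k :: x.map Bool.toNat) t ((x, k) ∈ L) ∧ t ≤ (x.length + 2) ^ f k

/-- The parameterized problem Max Lin AA: `(x, k)` is a yes-instance if `x` encodes a weighted system
whose maximum excess is at least the parameter `k`. -/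
def maxLinAA : Set (List Bool × ℕ) :=
  {p | ∃ (n m : ℕ) (S : System n m), p.1 = S.toBits ∧ (p.2 : ℤ) ≤ S.maxExcess}

end MaxLin

/-!
Suppose that some assignment `z` has excess at least `k`, and group the equations by their
left-hand sides. Equations whose left-hand side is zero contribute a constant. If this constant
is still below `k`, then some class of equations with a common nonzero left-hand side
contributes positively, and `z` satisfies one of its equations. Eliminating a variable by means
of that equation keeps the excess of `z`, and turns exactly this class into equations with
left-hand side zero, so that the constant grows by at least `1` and the number of nonzero
left-hand sides drops. After `min k m` such steps the constant is at least `k`. Conversely,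
eliminations along any sequence of equations only produce systems whose excesses are attained in
the original system, and the constant, as the average excess, is at most the maximum excess.
Hence it suffices to try all `m ^ min k m` sequences of equations, each in polynomial time.

The programs for this are written in a loop language. As long as the variables that bound the
loops are not changed, the running time is at most a constant times a power of these variables,
whose exponent is the nesting depth of the loops.
-/

namespace MaxLin

/-! ### A loop language over named variables -/

section LoopLanguage

variable {V : Type*}

/-- Arithmetic expressions over program variables; `deref e` is the content of the memory cell
`e`. -/
inductive Expr (V : Type*) where
  | lit (a : ℕ)
  | var (x : V)
  | add (e f : Expr V)
  | sub (e f : Expr V)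
  | deref (e : Expr V)

/-- Commands; `rep y c` runs the command `c` as many times as the value of `y` says on entry. -/
inductive Cmd (V : Type*) where
  | skip
  | assign (x : V) (e : Expr V)
  | store (a e : Expr V)
  | seq (c d : Cmd V)
  | branch (e : Expr V) (c d : Cmd V)
  | rep (y : V) (c : Cmd V)

/-- The values of the program variables and the contents of the memory cells. -/
structure Env (V : Type*) where
  val : V → ℕ
  mem : ℕ → ℕ

instance : Coe V (Expr V) := ⟨.var⟩
instance (a : ℕ) : OfNat (Expr V) a := ⟨.lit a⟩
instance : Add (Expr V) := ⟨.add⟩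
instance : Sub (Expr V) := ⟨.sub⟩

infix:62 " ≔ " => Cmd.assign
infixr:61 " ;; " => Cmd.seq

namespace Expr

/-- The value of an expression. -/
def eval (σ : Env V) : Expr V → ℕ
  | lit a => a
  | var x => σ.val x
  | add e f => e.eval σ + f.eval σ
  | sub e f => e.eval σ - f.eval σ
  | deref e => σ.mem (e.eval σ)

/-- The number of elementary instructions that evaluate the expression. -/
def cost : Expr V → ℕ
  | lit _ | var _ => 1
  | add e f | sub e f => e.cost + f.cost + 1
  | deref e => e.cost + 1

variable (σ : Env V) (e f : Expr V)

@[simp] lemma eval_ofNat (a : ℕ) : eval σ (no_index (OfNat.ofNat a)) = OfNat.ofNat a := rfl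
@[simp] lemma eval_var (x : V) : eval σ (.var x) = σ.val x := rfl
@[simp] lemma eval_add : eval σ (e + f) = e.eval σ + f.eval σ := rfl
@[simp] lemma eval_sub : eval σ (e - f) = e.eval σ - f.eval σ := rfl
@[simp] lemma eval_deref : eval σ (deref e) = σ.mem (e.eval σ) := rfl

end Expr

namespace Env

variable (σ : Env V) (x : V) (p a : ℕ)

/-- Store `a` in the memory cell `p`. -/
def put : Env V := { σ with mem := Function.update σ.mem p a }

@[simp] lemma val_put : (σ.put p a).val = σ.val := rfl
@[simp] lemma mem_put : (σ.put p a).mem = Function.update σ.mem p a := rfl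

variable [DecidableEq V]

/-- Give the variable `x` the value `a`. -/
def set : Env V := { σ with val := Function.update σ.val x a }

@[simp] lemma val_set_self : (σ.set x a).val x = a := by simp [set]

@[simp] lemma val_set_of_ne {y : V} (h : y ≠ x) : (σ.set x a).val y = σ.val y := by
  simp [set, h]

@[simp] lemma mem_set : (σ.set x a).mem = σ.mem := rfl

end Env

namespace Cmd

variable [DecidableEq V]

/-- The environment in which a command ends. -/
def run : Cmd V → Env V → Env V
  | skip, σ => σ
  | x ≔ e, σ => σ.set x (e.eval σ)
  | store a e, σ => σ.put (a.eval σ) (e.eval σ)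
  | c ;; d, σ => d.run (c.run σ)
  | branch e c d, σ => if 0 < e.eval σ then c.run σ else d.run σ
  | rep y c, σ => c.run^[σ.val y] σ

/-- The exact running time of the compiled command. -/
def time : Cmd V → Env V → ℕ
  | skip, _ => 1
  | _ ≔ e, _ => e.cost + 1
  | store a e, _ => a.cost + e.cost + 1
  | c ;; d, σ => c.time σ + d.time (c.run σ)
  | branch e c d, σ => e.cost + (if 0 < e.eval σ then c.time σ else d.time σ) + 1
  | rep y c, σ => 1 + (∑ i ∈ Finset.range (σ.val y), (c.time (c.run^[i] σ) + 3) + 1)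

variable (σ : Env V) (c d : Cmd V)

@[simp] lemma run_skip : run skip σ = σ := rfl
@[simp] lemma run_assign (x : V) (e : Expr V) : run (x ≔ e) σ = σ.set x (e.eval σ) := rfl
@[simp] lemma run_store (a e : Expr V) : run (store a e) σ = σ.put (a.eval σ) (e.eval σ) := rfl
@[simp] lemma run_seq : run (c ;; d) σ = d.run (c.run σ) := rfl

lemma run_branch (e : Expr V) :
    run (branch e c d) σ = if 0 < e.eval σ then c.run σ else d.run σ := rfl

lemma run_rep (y : V) : run (rep y c) σ = c.run^[σ.val y] σ := rfl

lemma time_seq : time (c ;; d) σ = c.time σ + d.time (c.run σ) := rfl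

end Cmd

end LoopLanguage

section Compiler

variable {V : Type*}

/-- Program variables live in the even registers, numbered by `ι`, and the temporaries of the
compiled code in the odd ones. -/
structure Represents (ι : V → ℕ) (σ : Env V) (s : State) : Prop where
  reg : ∀ x, s.reg (2 * ι x) = σ.val x
  mem : s.mem = σ.mem

/-- The register that holds the temporary `d`. -/
def temp (d : ℕ) : ℕ := 2 * d + 1

/-- The temporaries below `d` are the same in both configurations. -/
def KeepsTemps (d : ℕ) (s s' : State) : Prop := ∀ i < d, s'.reg (temp i) = s.reg (temp i)

variable {ι : V → ℕ} {σ : Env V} {s s' s'' : State} {d e : ℕ}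

lemma KeepsTemps.trans (h : KeepsTemps d s s') (h' : KeepsTemps d s' s'') : KeepsTemps d s s'' :=
  fun i hi => (h' i hi).trans (h i hi)

lemma KeepsTemps.mono (hde : d ≤ e) (h : KeepsTemps e s s') : KeepsTemps d s s' :=
  fun i hi => h i (hi.trans_le hde)

lemma keepsTemps_update (a : ℕ) (μ : ℕ → ℕ) :
    KeepsTemps d s ⟨Function.update s.reg (temp d) a, μ⟩ := fun i hi =>
  Function.update_of_ne (by simp only [temp]; omega) ..

lemma Represents.update_temp (h : Represents ι σ s) (d a : ℕ) :
    Represents ι σ ⟨Function.update s.reg (temp d) a, s.mem⟩ :=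
  ⟨fun x => (Function.update_of_ne (by simp only [temp]; omega) ..).trans (h.reg x), h.mem⟩

/-- The code that evaluates an expression into the temporary `d`, without touching the
temporaries below `d`. -/
def Expr.code (ι : V → ℕ) : ℕ → Expr V → Prog
  | d, lit a => .instr (.const (temp d) a)
  | d, var x => .instr (.copy (temp d) (2 * ι x))
  | d, add e f =>
      .seq (.seq (e.code ι d) (f.code ι (d + 1))) (.instr (.add (temp d) (temp d) (temp (d + 1))))
  | d, sub e f =>
      .seq (.seq (e.code ι d) (f.code ι (d + 1))) (.instr (.sub (temp d) (temp d) (temp (d + 1))))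
  | d, deref e => .seq (e.code ι d) (.instr (.load (temp d) (temp d)))

/-- The code of a command; a loop keeps its counter in the temporary `d`. -/
def Cmd.code (ι : V → ℕ) : ℕ → Cmd V → Prog
  | d, skip => .instr (.const (temp d) 0)
  | d, x ≔ e => .seq (e.code ι d) (.instr (.copy (2 * ι x) (temp d)))
  | d, store a e =>
      .seq (.seq (a.code ι d) (e.code ι (d + 1))) (.instr (.store (temp d) (temp (d + 1))))
  | d, c ;; c' => .seq (c.code ι d) (c'.code ι d)
  | d, branch e c c' => .seq (e.code ι d) (.ifPos (temp d) (c.code ι d) (c'.code ι d))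
  | d, rep y c =>
      .seq (.instr (.copy (temp d) (2 * ι y)))
        (.whilePos (temp d) (.seq (c.code ι (d + 1))
          (.seq (.instr (.const (temp (d + 1)) 1))
            (.instr (.sub (temp d) (temp d) (temp (d + 1)))))))

/-- The code of `e` leaves the value of `e` in the temporary `d` and takes `e.cost` steps. -/
def Expr.Evaluates (ι : V → ℕ) (d : ℕ) (e : Expr V) (σ : Env V) (s : State) : Prop :=
  ∃ s', Exec (e.code ι d) s e.cost s' ∧ s'.reg (temp d) = e.eval σ ∧ Represents ι σ s' ∧
    KeepsTemps d s s'

lemma Expr.exists_exec_pair {e f : Expr V} (h : Represents ι σ s)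
    (he : ∀ {s}, Represents ι σ s → e.Evaluates ι d σ s)
    (hf : ∀ {s}, Represents ι σ s → f.Evaluates ι (d + 1) σ s) :
    ∃ s', Exec (.seq (e.code ι d) (f.code ι (d + 1))) s (e.cost + f.cost) s' ∧
      s'.reg (temp d) = e.eval σ ∧ s'.reg (temp (d + 1)) = f.eval σ ∧ Represents ι σ s' ∧
      KeepsTemps d s s' := by
  obtain ⟨s₁, exec₁, val₁, rep₁, keep₁⟩ := he h
  obtain ⟨s₂, exec₂, val₂, rep₂, keep₂⟩ := hf rep₁
  exact ⟨s₂, exec₁.seq exec₂, (keep₂ d d.lt_succ_self).trans val₁, val₂, rep₂,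
    keep₁.trans (keep₂.mono d.le_succ)⟩

lemma Expr.evaluates (e : Expr V) (h : Represents ι σ s) : e.Evaluates ι d σ s := by
  induction e generalizing d s with
  | lit a =>
    exact ⟨_, .instr _ _, Function.update_self .., h.update_temp d a, keepsTemps_update _ _⟩
  | var x =>
    exact ⟨_, .instr _ _, (Function.update_self ..).trans (h.reg x), h.update_temp d _,
      keepsTemps_update _ _⟩
  | add e f ihe ihf =>
    obtain ⟨s', exec, vale, valf, rep, keep⟩ := exists_exec_pair (d := d) h ihe ihf
    refine ⟨_, exec.seq (.instr _ _), (Function.update_self ..).trans ?_, rep.update_temp d _,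
      keep.trans (keepsTemps_update _ _)⟩
    rw [vale, valf, eval]
  | sub e f ihe ihf =>
    obtain ⟨s', exec, vale, valf, rep, keep⟩ := exists_exec_pair (d := d) h ihe ihf
    refine ⟨_, exec.seq (.instr _ _), (Function.update_self ..).trans ?_, rep.update_temp d _,
      keep.trans (keepsTemps_update _ _)⟩
    rw [vale, valf, eval]
  | deref e ih =>
    obtain ⟨s', exec, val, rep, keep⟩ := ih (d := d) h
    refine ⟨_, exec.seq (.instr _ _), (Function.update_self ..).trans ?_, rep.update_temp d _,
      keep.trans (keepsTemps_update _ _)⟩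
    rw [val, rep.mem, eval]

variable [DecidableEq V]

lemma Represents.set (hι : ι.Injective) (h : Represents ι σ s) (x : V) (a : ℕ) :
    Represents ι (σ.set x a) ⟨Function.update s.reg (2 * ι x) a, s.mem⟩ where
  reg y := by
    rcases eq_or_ne y x with rfl | hyx
    · simp
    · have : 2 * ι y ≠ 2 * ι x := fun h => hyx (hι (by omega))
      simp [hyx, this, h.reg]
  mem := h.mem

lemma keepsTemps_update_even (x a : ℕ) :
    KeepsTemps d s ⟨Function.update s.reg (2 * x) a, s.mem⟩ := fun i _ =>
  Function.update_of_ne (by simp only [temp]; omega) ..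

/-- The code of `c` carries out `c` in exactly `c.time σ` steps. -/
def Cmd.Simulates (ι : V → ℕ) (d : ℕ) (c : Cmd V) (σ : Env V) (s : State) : Prop :=
  ∃ s', Exec (c.code ι d) s (c.time σ) s' ∧ Represents ι (c.run σ) s' ∧ KeepsTemps d s s'

lemma Cmd.exists_exec_while {c : Cmd V} (N : ℕ) (h : Represents ι σ s) (hN : s.reg (temp d) = N)
    (hc : ∀ {σ s}, Represents ι σ s → c.Simulates ι (d + 1) σ s) :
    ∃ s', Exec (.whilePos (temp d) (.seq (c.code ι (d + 1))
          (.seq (.instr (.const (temp (d + 1)) 1))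
            (.instr (.sub (temp d) (temp d) (temp (d + 1))))))) s
        (∑ i ∈ Finset.range N, (c.time (c.run^[i] σ) + 3) + 1) s' ∧
      Represents ι (c.run^[N] σ) s' ∧ KeepsTemps d s s' := by
  induction N generalizing σ s with
  | zero => exact ⟨s, .whileFalse hN, h, fun _ _ => rfl⟩
  | succ N ih =>
    obtain ⟨s₁, exec₁, rep₁, keep₁⟩ := hc h
    have rep₂ := (rep₁.update_temp (d + 1) 1).update_temp d N
    have hd : temp d ≠ temp (d + 1) := by simp [temp]
    obtain ⟨s₃, exec₃, rep₃, keep₃⟩ := ih rep₂ (Function.update_self ..)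
    refine ⟨s₃, ?_, rep₃, ((keep₁.mono d.le_succ).trans ?_).trans keep₃⟩
    · have count : s₁.reg (temp d) - 1 = N := by rw [keep₁ d d.lt_succ_self, hN]; rfl
      have body := exec₁.seq ((Exec.instr (.const (temp (d + 1)) 1) s₁).seq
        (.instr (.sub (temp d) (temp d) (temp (d + 1))) _))
      simp only [Instr.apply, Function.update_self, Function.update_of_ne hd, count] at body
      convert Exec.whileTrue (by omega) body exec₃ using 1
      rw [Finset.sum_range_succ']
      simp only [Function.iterate_succ_apply, Function.iterate_zero_apply]
      omega
    · exact ((keepsTemps_update 1 s₁.mem).mono d.le_succ).trans (keepsTemps_update _ _)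

theorem Cmd.simulates (hι : ι.Injective) (c : Cmd V) (h : Represents ι σ s) :
    c.Simulates ι d σ s := by
  induction c generalizing d σ s with
  | skip => exact ⟨_, .instr _ _, h.update_temp d 0, keepsTemps_update _ _⟩
  | assign x e =>
    obtain ⟨s', exec, val, rep, keep⟩ := e.evaluates (d := d) h
    refine ⟨_, exec.seq (.instr _ _), ?_, keep.trans (keepsTemps_update_even _ _)⟩
    rw [run_assign, ← val]
    exact rep.set hι x _
  | store a e =>
    obtain ⟨s', exec, vala, vale, rep, keep⟩ :=
      Expr.exists_exec_pair (d := d) h a.evaluates e.evaluates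
    refine ⟨_, exec.seq (.instr _ _), ⟨rep.reg, ?_⟩, keep⟩
    simp only [Instr.apply, vala, vale, rep.mem, run_store, Env.mem_put]
  | seq c c' ihc ihc' =>
    obtain ⟨s₁, exec₁, rep₁, keep₁⟩ := ihc (d := d) h
    obtain ⟨s₂, exec₂, rep₂, keep₂⟩ := ihc' (d := d) rep₁
    exact ⟨s₂, exec₁.seq exec₂, rep₂, keep₁.trans keep₂⟩
  | branch e c c' ihc ihc' =>
    obtain ⟨s₁, exec₁, val, rep₁, keep₁⟩ := e.evaluates (d := d) h
    by_cases pos : 0 < e.eval σ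
    · obtain ⟨s₂, exec₂, rep₂, keep₂⟩ := ihc (d := d) rep₁
      refine ⟨s₂, ?_, by rwa [run_branch, if_pos pos], keep₁.trans keep₂⟩
      rw [time, if_pos pos]
      exact exec₁.seq (.ifTrue (val ▸ pos) exec₂)
    · obtain ⟨s₂, exec₂, rep₂, keep₂⟩ := ihc' (d := d) rep₁
      refine ⟨s₂, ?_, by rwa [run_branch, if_neg pos], keep₁.trans keep₂⟩
      rw [time, if_neg pos]
      exact exec₁.seq (.ifFalse (val ▸ Nat.eq_zero_of_not_pos pos) exec₂)
  | rep y c ih =>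
    obtain ⟨s', exec, rep, keep⟩ := exists_exec_while (d := d) (σ.val y)
      (h.update_temp d (s.reg (2 * ι y))) ((Function.update_self ..).trans (h.reg y)) ih
    exact ⟨s', (Exec.instr _ s).seq exec, rep, (keepsTemps_update _ _).trans keep⟩

end Compiler

section StaticAnalysis

variable {V : Type*}

namespace Cmd

/-- The variables to which a command may assign. -/
def writes : Cmd V → List V
  | skip | store _ _ => []
  | x ≔ _ => [x]
  | c ;; d | branch _ c d => c.writes ++ d.writes
  | rep _ c => c.writes

/-- Whether a command may change the memory. -/
def stores : Cmd V → Bool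
  | skip | _ ≔ _ => false
  | store _ _ => true
  | c ;; d | branch _ c d => c.stores || d.stores
  | rep _ c => c.stores

/-- The variables that bound the loops of a command. -/
def bounds : Cmd V → List V
  | skip | _ ≔ _ | store _ _ => []
  | c ;; d | branch _ c d => c.bounds ++ d.bounds
  | rep y c => y :: c.bounds

/-- The nesting depth of the loops of a command. -/
def depth : Cmd V → ℕ
  | skip | _ ≔ _ | store _ _ => 0
  | c ;; d | branch _ c d => max c.depth d.depth
  | rep _ c => c.depth + 1

/-- The running time with every loop counted as a single iteration. -/
def cost : Cmd V → ℕ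
  | skip => 1
  | _ ≔ e => e.cost + 1
  | store a e => a.cost + e.cost + 1
  | c ;; d => c.cost + d.cost
  | branch e c d => e.cost + 1 + (c.cost + d.cost)
  | rep _ c => c.cost + 5

variable [DecidableEq V] {σ : Env V} {x : V} {c : Cmd V} {B : ℕ}

lemma iterate_run_val (h : ∀ σ, (c.run σ).val x = σ.val x) (N : ℕ) :
    (c.run^[N] σ).val x = σ.val x := by
  induction N with
  | zero => rfl
  | succ N ih => rw [Function.iterate_succ_apply', h, ih]

lemma run_val (h : x ∉ c.writes) : (c.run σ).val x = σ.val x := by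
  induction c generalizing σ with
  | skip | store => rfl
  | assign y e => exact Env.val_set_of_ne _ _ _ (by simpa [writes] using h)
  | seq c d ihc ihd =>
    obtain ⟨hc, hd⟩ : x ∉ c.writes ∧ x ∉ d.writes := by simpa [writes] using h
    rw [run_seq, ihd hd, ihc hc]
  | branch e c d ihc ihd =>
    obtain ⟨hc, hd⟩ : x ∉ c.writes ∧ x ∉ d.writes := by simpa [writes] using h
    rw [run_branch]
    split
    exacts [ihc hc, ihd hd]
  | rep y c ih => exact iterate_run_val (fun _ => ih h) _

lemma run_mem (h : c.stores = false) : (c.run σ).mem = σ.mem := by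
  induction c generalizing σ with
  | skip | assign => rfl
  | store => simp [stores] at h
  | seq c d ihc ihd =>
    obtain ⟨hc, hd⟩ : c.stores = false ∧ d.stores = false := by simpa [stores] using h
    rw [run_seq, ihd hd, ihc hc]
  | branch e c d ihc ihd =>
    obtain ⟨hc, hd⟩ : c.stores = false ∧ d.stores = false := by simpa [stores] using h
    rw [run_branch]
    split
    exacts [ihc hc, ihd hd]
  | rep y c ih =>
    rw [run_rep]
    generalize σ.val y = N
    induction N with
    | zero => rfl
    | succ N ihN => rw [Function.iterate_succ_apply', ih h, ihN]

lemma time_rep_le (y : V) {T : ℕ} (h : ∀ i < σ.val y, c.time (c.run^[i] σ) ≤ T) :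
    (rep y c).time σ ≤ σ.val y * (T + 3) + 2 := by
  have := Finset.sum_le_card_nsmul (Finset.range (σ.val y)) _ (T + 3)
    fun i hi => Nat.add_le_add_right (h i (Finset.mem_range.mp hi)) 3
  rw [Finset.card_range, smul_eq_mul] at this
  rw [time]
  omega

theorem time_le (hw : ∀ x ∈ c.bounds, x ∉ c.writes) (hB : ∀ x ∈ c.bounds, σ.val x ≤ B) :
    c.time σ ≤ c.cost * (B + 1) ^ c.depth := by
  induction c generalizing σ with
  | skip | assign | store => simp [time, cost, depth]
  | seq c d ihc ihd =>
    simp only [bounds, writes, List.mem_append] at hw hB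
    have hc := ihc (fun x hx h => hw x (.inl hx) (.inl h)) fun x hx => hB x (.inl hx)
    have hd := ihd (σ := c.run σ) (fun x hx h => hw x (.inr hx) (.inr h)) fun x hx =>
      (run_val fun h => hw x (.inr hx) (.inl h)).trans_le (hB x (.inr hx))
    calc c.time σ + d.time (c.run σ)
        ≤ c.cost * (B + 1) ^ c.depth + d.cost * (B + 1) ^ d.depth := by gcongr
      _ ≤ c.cost * (B + 1) ^ max c.depth d.depth + d.cost * (B + 1) ^ max c.depth d.depth := by
        gcongr <;> omega
      _ = (c ;; d).cost * (B + 1) ^ (c ;; d).depth := by rw [cost, depth]; ring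
  | branch e c d ihc ihd =>
    simp only [bounds, writes, List.mem_append] at hw hB
    have hc := ihc (fun x hx h => hw x (.inl hx) (.inl h)) fun x hx => hB x (.inl hx)
    have hd := ihd (fun x hx h => hw x (.inr hx) (.inr h)) fun x hx => hB x (.inr hx)
    calc (branch e c d).time σ
        ≤ (e.cost + 1) * 1 + (c.time σ + d.time σ) := by rw [time]; split <;> omega
      _ ≤ (e.cost + 1) * (B + 1) ^ max c.depth d.depth +
          (c.cost * (B + 1) ^ c.depth + d.cost * (B + 1) ^ d.depth) := by
        gcongr; exact Nat.one_le_pow _ _ B.succ_pos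
      _ ≤ (e.cost + 1) * (B + 1) ^ max c.depth d.depth +
          (c.cost * (B + 1) ^ max c.depth d.depth + d.cost * (B + 1) ^ max c.depth d.depth) := by
        gcongr <;> omega
      _ = (branch e c d).cost * (B + 1) ^ (branch e c d).depth := by rw [cost, depth]; ring
  | rep y c ih =>
    simp only [bounds, writes, List.mem_cons] at hw hB
    have hc (i : ℕ) : c.time (c.run^[i] σ) ≤ c.cost * (B + 1) ^ c.depth :=
      ih (fun x hx => hw x (.inr hx)) fun x hx =>
        (iterate_run_val (fun _ => run_val (hw x (.inr hx))) i).trans_le (hB x (.inr hx))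
    have one_le : 1 ≤ (B + 1) ^ c.depth := Nat.one_le_pow _ _ B.succ_pos
    calc (rep y c).time σ
        ≤ σ.val y * (c.cost * (B + 1) ^ c.depth + 3) + 2 := time_rep_le y fun i _ => hc i
      _ ≤ B * (c.cost * (B + 1) ^ c.depth + 3) + 2 := by gcongr; exact hB y (.inl rfl)
      _ ≤ (c.cost + 5) * ((B + 1) ^ c.depth * (B + 1)) := by nlinarith
      _ = (rep y c).cost * (B + 1) ^ (rep y c).depth := by rw [cost, depth, pow_succ]

end Cmd

end StaticAnalysis

section Loops

variable {V : Type*}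

/-- The memory `μ` with the `len` cells from `a` on overwritten by `f 0, f 1, …`. -/
def fill (μ : ℕ → ℕ) (a len : ℕ) (f : ℕ → ℕ) (p : ℕ) : ℕ :=
  if a ≤ p ∧ p < a + len then f (p - a) else μ p

lemma fill_zero (μ f : ℕ → ℕ) (a : ℕ) : fill μ a 0 f = μ :=
  funext fun _ => if_neg (by omega)

lemma fill_succ (μ f : ℕ → ℕ) (a len : ℕ) :
    fill μ a (len + 1) f = Function.update (fill μ a len f) (a + len) (f len) := by
  ext p
  rcases eq_or_ne p (a + len) with rfl | hp
  · simp [fill]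
  · have : p < a + (len + 1) ↔ p < a + len := by omega
    simp only [fill, this, Function.update_of_ne hp]

lemma fill_add (μ f : ℕ → ℕ) {a len j : ℕ} (h : j < len) : fill μ a len f (a + j) = f j := by
  simp [fill, h]

lemma fill_of_lt (μ f : ℕ → ℕ) {a len p : ℕ} (h : p < a) : fill μ a len f p = μ p :=
  if_neg (by omega)

lemma fill_of_le (μ f : ℕ → ℕ) {a len p : ℕ} (h : a + len ≤ p) : fill μ a len f p = μ p :=
  if_neg (by omega)

lemma fill_congr {μ f g : ℕ → ℕ} {a len : ℕ} (h : ∀ c < len, f c = g c) :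
    fill μ a len f = fill μ a len g := by
  ext p
  unfold fill
  split_ifs
  exacts [h _ (by omega), rfl]

namespace Cmd

/-- The loop `for i = 0, …, y - 1 do c`. -/
def forTo (i y : V) (c : Cmd V) : Cmd V :=
  i ≔ 0 ;; rep y (c ;; i ≔ .var i + 1)

/-- Copy the `y` cells from address `b` on to the cells from address `a` on, counting with `i`. -/
def copyCells (i y a b : V) : Cmd V :=
  forTo i y (store (.var a + .var i) (.deref (.var b + .var i)))

/-- Add the product of `y` and `z` to `x`. -/
def addMul (x y z : V) : Cmd V :=
  rep y (x ≔ .var x + .var z)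

variable [DecidableEq V] {σ : Env V} {i y : V} {c : Cmd V}

theorem run_rep_induction {I : ℕ → Env V → Prop} (zero : I 0 σ)
    (succ : ∀ j < σ.val y, ∀ τ, (∀ x ∉ c.writes, τ.val x = σ.val x) → I j τ → I (j + 1) (c.run τ)) :
    I (σ.val y) ((rep y c).run σ) := by
  suffices inv : ∀ j ≤ σ.val y, (∀ x ∉ c.writes, (c.run^[j] σ).val x = σ.val x) ∧
      I j (c.run^[j] σ) from (inv _ le_rfl).2
  intro j hj
  induction j with
  | zero => exact ⟨fun _ _ => rfl, zero⟩
  | succ j ih =>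
    obtain ⟨frame, inv⟩ := ih (by omega)
    rw [Function.iterate_succ_apply']
    exact ⟨fun x hx => (run_val hx).trans (frame x hx), succ j hj _ frame inv⟩

lemma run_addMul {x z : V} (hz : z ≠ x) :
    (addMul x y z).run σ = σ.set x (σ.val x + σ.val y * σ.val z) := by
  refine run_rep_induction (I := fun j τ => τ = σ.set x (σ.val x + j * σ.val z)) ?_ ?_
  · simp [Env.set]
  · rintro j - τ - rfl
    simp [Env.set, hz, Nat.succ_mul, add_assoc]

theorem run_forTo_induction {I : ℕ → Env V → Prop} (hy : y ≠ i) (hi : i ∉ c.writes)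
    (zero : I 0 (σ.set i 0))
    (succ : ∀ j < σ.val y, ∀ τ, τ.val i = j → (∀ x ∉ (forTo i y c).writes, τ.val x = σ.val x) →
      I j τ → I (j + 1) ((c.run τ).set i (j + 1))) :
    I (σ.val y) ((forTo i y c).run σ) := by
  have bound : (σ.set i 0).val y = σ.val y := Env.val_set_of_ne _ _ _ hy
  refine bound ▸ (run_rep_induction (I := fun j τ => τ.val i = j ∧ I j τ)
    ⟨Env.val_set_self .., zero⟩ fun j hj τ frame ⟨val_i, inv⟩ => ?_).2
  have run_body : (c ;; i ≔ .var i + 1).run τ = (c.run τ).set i (j + 1) := by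
    simp only [run_seq, run_assign, Expr.eval_add, Expr.eval_var, Expr.eval_ofNat, run_val hi,
      val_i]
  rw [run_body]
  refine ⟨Env.val_set_self .., succ j (bound ▸ hj) τ val_i (fun x hx => ?_) inv⟩
  obtain ⟨hxi, hxc⟩ : x ≠ i ∧ x ∉ (c ;; i ≔ .var i + 1).writes := by
    simpa [forTo, writes] using hx
  rw [frame x hxc, Env.val_set_of_ne _ _ _ hxi]

theorem run_forTo_store {a e : Expr V} {base : ℕ} {f : ℕ → ℕ} (hy : y ≠ i)
    (h : ∀ j < σ.val y, ∀ τ : Env V, τ.val i = j → (∀ x ≠ i, τ.val x = σ.val x) →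
      τ.mem = fill σ.mem base j f → a.eval τ = base + j ∧ e.eval τ = f j) :
    ((forTo i y (store a e)).run σ).mem = fill σ.mem base (σ.val y) f := by
  refine run_forTo_induction (I := fun j τ => τ.mem = fill σ.mem base j f) hy
    (List.not_mem_nil) (fill_zero ..).symm fun j hj τ val_i frame mem_eq => ?_
  obtain ⟨addr, value⟩ :=
    h j hj τ val_i (fun x hx => frame x (by simp [forTo, writes, hx])) mem_eq
  rw [Env.mem_set, run_store, Env.mem_put, addr, value, mem_eq, fill_succ]

lemma run_copyCells_mem {a b : V} (hy : y ≠ i) (ha : a ≠ i) (hb : b ≠ i)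
    (disj : σ.val b + σ.val y ≤ σ.val a ∨ σ.val a + σ.val y ≤ σ.val b) :
    ((copyCells i y a b).run σ).mem =
      fill σ.mem (σ.val a) (σ.val y) fun c => σ.mem (σ.val b + c) := by
  refine run_forTo_store hy fun j hj τ val_i frame mem_eq => ?_
  simp only [Expr.eval_add, Expr.eval_var, Expr.eval_deref, val_i, frame a ha, frame b hb, mem_eq,
    true_and]
  rcases disj with disj | disj
  exacts [fill_of_lt _ _ (by omega), fill_of_le _ _ (by omega)]

end Cmd

end Loops

/-! ### Elimination along tuples of equations -/

/-- The equation `∑ i, e.1 i * z i = e.2` over `𝔽₂`; equations form an `𝔽₂`-vector space. -/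
abbrev Eqn (κ : Type*) := (κ → ZMod 2) × ZMod 2

/-- The nontrivial character of `𝔽₂`: `1` for a satisfied equation, `-1` for a falsified one. -/
def sgn (a : ZMod 2) : ℤ := if a = 0 then 1 else -1

lemma sgn_add_one (a : ZMod 2) : sgn (a + 1) = -sgn a := by
  revert a; decide

lemma zmod_two_eq_one {a : ZMod 2} (h : a ≠ 0) : a = 1 := by
  revert a; decide

section Excess

variable {ι κ : Type*} [Fintype ι] [Fintype κ]

/-- The amount `0` or `1` by which the assignment `z` violates the equation `e`. -/
def Eqn.defect (e : Eqn κ) (z : κ → ZMod 2) : ZMod 2 := e.1 ⬝ᵥ z + e.2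

/-- The excess of the assignment `z` for the equations `M` with the weights `w`. -/
def excess (M : ι → Eqn κ) (w : ι → ℕ) (z : κ → ZMod 2) : ℤ :=
  ∑ i, w i * sgn ((M i).defect z)

/-- The contribution to the excess of the equations without variables, which does not depend on
the assignment. -/
def constWeight (M : ι → Eqn κ) (w : ι → ℕ) : ℤ :=
  ∑ i with (M i).1 = 0, w i * sgn (M i).2

lemma Eqn.defect_of_left_eq_zero {e : Eqn κ} (h : e.1 = 0) (z : κ → ZMod 2) :
    e.defect z = e.2 := by
  rw [defect, h, zero_dotProduct, zero_add]

lemma Eqn.defect_add_smul (e f : Eqn κ) (a : ZMod 2) (z : κ → ZMod 2) :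
    Eqn.defect (e + a • f) z = e.defect z + a * f.defect z := by
  simp only [defect, Prod.fst_add, Prod.snd_add, Prod.smul_fst, Prod.smul_snd, add_dotProduct,
    smul_dotProduct, smul_eq_mul]
  ring

lemma constWeight_eq_sum_sgn_defect (M : ι → Eqn κ) (w : ι → ℕ) (z : κ → ZMod 2) :
    constWeight M w = ∑ i with (M i).1 = 0, w i * sgn ((M i).defect z) :=
  Finset.sum_congr rfl fun i hi => by
    rw [Eqn.defect_of_left_eq_zero (Finset.mem_filter.mp hi).2]

lemma constWeight_eq_excess {M : ι → Eqn κ} (h : ∀ i, (M i).1 = 0) (w : ι → ℕ)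
    (z : κ → ZMod 2) : constWeight M w = excess M w z := by
  rw [constWeight_eq_sum_sgn_defect M w z, excess, Finset.filter_true_of_mem fun i _ => h i]

section Averaging

variable [DecidableEq κ]

lemma Eqn.defect_add_single (e : Eqn κ) (z : κ → ZMod 2) (p : κ) (a : ZMod 2) :
    e.defect (z + Pi.single p a) = e.defect z + e.1 p * a := by
  rw [defect, defect, dotProduct_add, dotProduct_single]
  ring

lemma Eqn.sum_sgn_defect (e : Eqn κ) :
    ∑ z, sgn (e.defect z) = if e.1 = 0 then 2 ^ Fintype.card κ * sgn e.2 else 0 := by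
  split_ifs with h
  · simp [defect_of_left_eq_zero h]
  · obtain ⟨p, hp⟩ := Function.ne_iff.mp h
    have flip (z : κ → ZMod 2) : sgn (e.defect (z + Pi.single p 1)) = -sgn (e.defect z) := by
      rw [defect_add_single, zmod_two_eq_one hp, mul_one, sgn_add_one]
    have := Equiv.sum_comp (Equiv.addRight (Pi.single p 1)) fun z => sgn (e.defect z)
    simp only [Equiv.coe_addRight, flip, Finset.sum_neg_distrib] at this
    omega

lemma sum_excess (M : ι → Eqn κ) (w : ι → ℕ) :
    ∑ z, excess M w z = 2 ^ Fintype.card κ * constWeight M w := by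
  simp only [excess]
  rw [Finset.sum_comm, constWeight, Finset.sum_filter, Finset.mul_sum]
  refine Finset.sum_congr rfl fun i _ => ?_
  rw [← Finset.mul_sum, Eqn.sum_sgn_defect]
  split_ifs <;> ring

end Averaging

lemma exists_constWeight_le_excess (M : ι → Eqn κ) (w : ι → ℕ) :
    ∃ z, constWeight M w ≤ excess M w z := by
  classical
  obtain ⟨z, -, hz⟩ := Finset.exists_le_of_sum_le Finset.univ_nonempty
    (f := fun _ : κ → ZMod 2 => constWeight M w) (g := excess M w) (by simp [sum_excess])
  exact ⟨z, hz⟩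

/-- The system in which the variable `p` has been eliminated by means of the equation `M j`. -/
def elim (M : ι → Eqn κ) (j : ι) (p : κ) (i : ι) : Eqn κ := M i + (M i).1 p • M j

variable {M : ι → Eqn κ} {w : ι → ℕ} {z : κ → ZMod 2} {j : ι} {p : κ}

omit [Fintype ι] in
lemma defect_elim (i : ι) :
    (elim M j p i).defect z = (M i).defect z + (M i).1 p * (M j).defect z :=
  Eqn.defect_add_smul ..

lemma excess_elim_of_defect_eq_zero (h : (M j).defect z = 0) :
    excess (elim M j p) w z = excess M w z := by
  simp only [excess, defect_elim, h, mul_zero, add_zero]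

lemma exists_excess_eq_excess_elim (M : ι → Eqn κ) (w : ι → ℕ) (j : ι) (p : κ)
    (z : κ → ZMod 2) : ∃ z', excess M w z' = excess (elim M j p) w z := by
  classical
  exact ⟨z + Pi.single p ((M j).defect z), by
    simp only [excess, defect_elim, Eqn.defect_add_single]⟩

omit [Fintype ι] [Fintype κ] in
lemma elim_left_eq_zero_iff (hp : (M j).1 p ≠ 0) (i : ι) :
    (elim M j p i).1 = 0 ↔ (M i).1 = 0 ∨ (M i).1 = (M j).1 := by
  have left : (elim M j p i).1 = (M i).1 + (M i).1 p • (M j).1 := rfl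
  rw [left]
  by_cases h : (M i).1 p = 0
  · have : (M i).1 ≠ (M j).1 := fun hij => hp (hij ▸ h)
    simp [h, this]
  · have : (M i).1 ≠ 0 := fun hi => h (congrFun hi p)
    rw [zmod_two_eq_one h, one_smul, ← ZModModule.sub_eq_add, sub_eq_zero]
    simp [this]

lemma constWeight_elim (hp : (M j).1 p ≠ 0) (hz : (M j).defect z = 0) :
    constWeight (elim M j p) w = constWeight M w +
      ∑ i with (M i).1 = (M j).1, w i * sgn ((M i).defect z) := by
  classical
  have disj : Disjoint (Finset.univ.filter fun i => (M i).1 = 0)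
      (Finset.univ.filter fun i => (M i).1 = (M j).1) :=
    Finset.disjoint_filter.mpr fun i _ hi hij => hp (by rw [← hij, hi, Pi.zero_apply])
  simp only [constWeight_eq_sum_sgn_defect _ _ z, elim_left_eq_zero_iff hp, defect_elim, hz,
    mul_zero, add_zero, Finset.filter_or, Finset.sum_union disj]

lemma card_left_eq_zero_lt_card_elim (hp : (M j).1 p ≠ 0) :
    Fintype.card {i // (M i).1 = 0} < Fintype.card {i // (elim M j p i).1 = 0} := by
  classical
  simp only [Fintype.card_subtype, elim_left_eq_zero_iff hp]
  refine Finset.card_lt_card (Finset.ssubset_iff_of_subset ?_ |>.mpr ⟨j, ?_, ?_⟩)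
  · exact Finset.monotone_filter_right _ fun i _ hi => .inl hi
  · simp
  · have : (M j).1 ≠ 0 := fun h => hp (congrFun h p)
    simp [this]

/-- Some class of equations with the same left-hand side contributes positively; it contains an
equation that `z` satisfies. -/
lemma exists_satisfied_class (h : constWeight M w < excess M w z) :
    ∃ j, (M j).1 ≠ 0 ∧ (M j).defect z = 0 ∧
      0 < ∑ i with (M i).1 = (M j).1, w i * sgn ((M i).defect z) := by
  classical
  have pos : 0 < ∑ v with v ≠ 0, ∑ i with (M i).1 = v, w i * sgn ((M i).defect z) := by
    rw [excess, ← Finset.sum_fiberwise _ fun i => (M i).1,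
      ← Finset.add_sum_erase _ _ (Finset.mem_univ 0), ← constWeight_eq_sum_sgn_defect,
      lt_add_iff_pos_right] at h
    rwa [Finset.filter_ne']
  obtain ⟨v, hv, class_pos⟩ := Finset.exists_lt_of_sum_lt (f := fun _ => (0 : ℤ)) (by simpa)
  obtain ⟨j, hj, hjz⟩ := Finset.exists_lt_of_sum_lt (f := fun _ => (0 : ℤ)) (by simpa)
  have hjv : (M j).1 = v := (Finset.mem_filter.mp hj).2
  refine ⟨j, hjv ▸ (Finset.mem_filter.mp hv).2, ?_, hjv ▸ class_pos⟩
  by_contra hne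
  rw [sgn, if_neg hne] at hjz
  omega

end Excess

section Step

variable {ι κ : Type*} [Fintype ι] [Fintype κ] [LinearOrder κ]

/-- The set of the variables that occur in an equation. -/
def Eqn.support (e : Eqn κ) : Finset κ := {i | e.1 i ≠ 0}

/-- One elimination step: the last variable of the equation `M j` is eliminated, if there is one. -/
def step (M : ι → Eqn κ) (j : ι) : ι → Eqn κ :=
  if h : (M j).support.Nonempty then elim M j ((M j).support.max' h) else M

variable {M : ι → Eqn κ} {w : ι → ℕ} {j : ι} {z : κ → ZMod 2} {k : ℕ}

omit [Fintype ι] in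
lemma step_of_left_eq_zero (h : (M j).1 = 0) : step M j = M :=
  dif_neg (by simp [Eqn.support, h])

omit [Fintype ι] in
lemma exists_step_eq_elim (h : (M j).1 ≠ 0) :
    ∃ p, (M j).1 p ≠ 0 ∧ step M j = elim M j p := by
  have hne : (M j).support.Nonempty := by
    simpa [Eqn.support, Finset.filter_nonempty_iff] using Function.ne_iff.mp h
  exact ⟨_, (Finset.mem_filter.mp ((M j).support.max'_mem hne)).2, dif_pos hne⟩

lemma exists_excess_eq_excess_step (M : ι → Eqn κ) (w : ι → ℕ) (j : ι) (z : κ → ZMod 2) :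
    ∃ z', excess M w z' = excess (step M j) w z := by
  unfold step
  split
  · exact exists_excess_eq_excess_elim ..
  · exact ⟨z, rfl⟩

lemma exists_constWeight_foldl_step_le (M : ι → Eqn κ) (w : ι → ℕ) (l : List ι) :
    ∃ z, constWeight (l.foldl step M) w ≤ excess M w z := by
  induction l generalizing M with
  | nil => exact exists_constWeight_le_excess M w
  | cons j l ih =>
    obtain ⟨z, hz⟩ := ih (step M j)
    obtain ⟨z', hz'⟩ := exists_excess_eq_excess_step M w j z
    exact ⟨z', hz'.symm ▸ hz⟩

/-- What `t` elimination steps towards the excess `k` have achieved for the assignment `z`. -/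
def Progress (k : ℕ) (w : ι → ℕ) (z : κ → ZMod 2) (M : ι → Eqn κ) (t : ℕ) : Prop :=
  (k : ℤ) ≤ excess M w z ∧ ((k : ℤ) ≤ constWeight M w ∨
    (t : ℤ) ≤ constWeight M w ∧ t ≤ Fintype.card {i // (M i).1 = 0})

lemma Progress.exists_step {t : ℕ} (h : Progress k w z M t) (ht : t < k) :
    ∃ j, Progress k w z (step M j) (t + 1) := by
  obtain ⟨le_excess, progress⟩ := h
  rcases le_or_gt (k : ℤ) (constWeight M w) with done | not_done
  · obtain ⟨j, hj⟩ : (Finset.univ.filter fun i => (M i).1 = 0).Nonempty := by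
      by_contra! empty
      rw [constWeight, empty, Finset.sum_empty] at done
      omega
    refine ⟨j, ?_⟩
    rw [step_of_left_eq_zero (Finset.mem_filter.mp hj).2]
    exact ⟨le_excess, .inl done⟩
  · obtain ⟨le_const, le_card⟩ := progress.resolve_left not_done.not_ge
    obtain ⟨j, hj, satisfied, gain⟩ := exists_satisfied_class (not_done.trans_le le_excess)
    obtain ⟨p, hp, step_eq⟩ := exists_step_eq_elim hj
    have const_eq := constWeight_elim (w := w) hp satisfied
    have card_lt := card_left_eq_zero_lt_card_elim hp
    rw [← step_eq] at const_eq card_lt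
    refine ⟨j, ?_, .inr ⟨?_, by omega⟩⟩
    · rwa [step_eq, excess_elim_of_defect_eq_zero satisfied]
    · push_cast
      omega

lemma Progress.exists_foldl_step (h : Progress k w z M 0) {t : ℕ} (ht : t ≤ k) :
    ∃ l : List ι, l.length = t ∧ Progress k w z (l.foldl step M) t := by
  induction t with
  | zero => exact ⟨[], rfl, h⟩
  | succ t ih =>
    obtain ⟨l, hl, progress⟩ := ih (by omega)
    obtain ⟨j, hj⟩ := progress.exists_step ht
    exact ⟨l ++ [j], by simp [hl], by simpa using hj⟩

omit [LinearOrder κ] in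
lemma Progress.le_constWeight (h : Progress k w z M (min k (Fintype.card ι))) :
    (k : ℤ) ≤ constWeight M w := by
  obtain ⟨le_excess, done | ⟨le_const, le_card⟩⟩ := h
  · exact done
  rcases le_total k (Fintype.card ι) with hk | hk
  · rwa [min_eq_left hk] at le_const
  · rw [min_eq_right hk] at le_card
    have trivial : ∀ i, (M i).1 = 0 := by
      have card_eq := (Fintype.card_subtype_le fun i => (M i).1 = 0).antisymm le_card
      rw [Fintype.card_subtype, Finset.card_eq_iff_eq_univ] at card_eq
      simpa [Finset.filter_eq_self] using card_eq
    rwa [constWeight_eq_excess trivial w z]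

theorem exists_le_excess_iff (h : 0 ≤ constWeight M w) :
    (∃ z, (k : ℤ) ≤ excess M w z) ↔ ∃ l : List ι, l.length = min k (Fintype.card ι) ∧
      (k : ℤ) ≤ constWeight (l.foldl step M) w := by
  constructor
  · rintro ⟨z, hz⟩
    have start : Progress k w z M 0 := ⟨hz, .inr ⟨by exact_mod_cast h, Nat.zero_le _⟩⟩
    obtain ⟨l, hl, progress⟩ := start.exists_foldl_step (min_le_left k (Fintype.card ι))
    exact ⟨l, hl, progress.le_constWeight⟩
  · rintro ⟨l, -, hl⟩
    obtain ⟨z, hz⟩ := exists_constWeight_foldl_step_le M w l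
    exact ⟨z, hl.trans hz⟩

end Step

namespace System

variable {n m : ℕ} (S : System n m)

/-- The equations of a system, without their weights. -/
def eqns (j : Fin m) : Eqn (Fin n) := (S.A j, S.b j)

lemma eqns_left_ne_zero (j : Fin m) : (S.eqns j).1 ≠ 0 :=
  Function.ne_iff.mpr (S.row_ne_zero j)

lemma excess_eq_excess_eqns (z : Fin n → ZMod 2) : S.excess z = MaxLin.excess S.eqns S.w z := by
  have satisfied (j : Fin m) : S.A.mulVec z j = S.b j ↔ (S.eqns j).defect z = 0 :=
    sub_eq_zero.symm.trans (by rw [ZModModule.sub_eq_add]; rfl)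
  simp only [excess, MaxLin.excess, sgn, satisfied, Finset.sum_filter, ne_eq, ite_not,
    ← Finset.sum_sub_distrib]
  exact Finset.sum_congr rfl fun j _ => by split_ifs <;> ring

theorem le_maxExcess_iff (k : ℕ) :
    (k : ℤ) ≤ S.maxExcess ↔
      ∃ l : List (Fin m), l.length = min k m ∧ (k : ℤ) ≤ constWeight (l.foldl step S.eqns) S.w := by
  have const : constWeight S.eqns S.w = 0 := by simp [constWeight, S.eqns_left_ne_zero]
  have := exists_le_excess_iff (k := k) const.ge
  rw [Fintype.card_fin] at this
  simp [maxExcess, ← this, Finset.le_sup'_iff, excess_eq_excess_eqns]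

end System

/-! ### The search program -/

/-- The variables of the programs. The first one is compiled to register `0`, which holds the
length of the input at the start and the answer at the end. -/
inductive Var where
  | io | k | n | m | src | width | cols | size | len | digits | buf | work | acc | count | found
  | i | c | t | row | chosen | last | gain | loss | carry | digit
  | next | bit | go | weight | place | canonical | valid
  deriving DecidableEq

lemma Var.ctorIdx_injective : Function.Injective Var.ctorIdx :=
  Function.LeftInverse.injective Var.ofNat_ctorIdx

section Programs

open Cmd Var

local notation "mem[" e "]" => (Expr.deref e : Expr Var)

/-- The distance of the values of `e` and `f`, which is positive if and only if they differ. -/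
def differ (e f : Expr Var) : Expr Var := (e - f) + (f - e)

/-- Run `body` for every row of the working copy of the table, with `row` at its address and `i` at
its index. -/
def forRows (body : Cmd Var) : Cmd Var :=
  row ≔ work ;; forTo i m (body ;; row ≔ row + width)

/-- Copy the row with the index `chosen` into the buffer. The row is found by running through the
table, since there is no multiplication to compute its address. -/
def fetch : Cmd Var :=
  forRows (branch (differ i chosen) skip (copyCells c width buf row))

/-- `last` becomes one plus the index of the last variable of the row at address `a`, or `0` if
there is none. -/
def findLast (a : Var) : Cmd Var :=
  last ≔ 0 ;; forTo c n (branch mem[a + c] (last ≔ c + 1) skip)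

/-- Add the equation in the buffer to the current row, modulo `2`. -/
def addBuffer : Cmd Var :=
  forTo c cols (store (row + c) (differ mem[row + c] mem[buf + c]))

/-- Eliminate the variable with the index `last - 1` from the current row, if it occurs there. -/
def eliminateRow : Cmd Var :=
  branch mem[row + last - 1] addBuffer skip

/-- Eliminate the variable with the index `last - 1` by means of the equation in the buffer. -/
def eliminate : Cmd Var :=
  forRows eliminateRow

/-- Fetch the equation that the tuple prescribes for the elimination step `t` and find its last
variable. -/
def choose : Cmd Var :=
  chosen ≔ mem[digits + t] ;; fetch ;; findLast buf

/-- The program for `step`. -/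
def elimStep : Cmd Var :=
  choose ;; branch last eliminate skip

/-- Count the weight of the current row for `gain` or `loss` if it has no variables. -/
def evaluateRow : Cmd Var :=
  findLast row ;; branch last skip (branch mem[row + n] (loss ≔ loss + mem[row + cols])
    (gain ≔ gain + mem[row + cols]))

/-- The program for `constWeight`, which becomes `gain - loss`. -/
def evaluate : Cmd Var :=
  gain ≔ 0 ;; loss ≔ 0 ;; forRows evaluateRow

/-- Eliminate in a fresh copy of the table along the whole tuple. -/
def reduce : Cmd Var :=
  copyCells c size work src ;; forTo t len elimStep

/-- Set `found` if the tuple in the memory shows that the excess `k` can be attained. -/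
def trial : Cmd Var :=
  reduce ;; evaluate ;; branch (gain + 1 - (loss + k)) (found ≔ 1) skip

/-- Add the carry to the digit `t`, in base `m`. -/
def incrementDigit : Cmd Var :=
  digit ≔ mem[digits + t] + carry ;; branch (m - digit) (carry ≔ 0) (digit ≔ 0 ;; carry ≔ 1) ;;
    store (digits + t) digit

/-- Pass to the next tuple of equations, read as a number in base `m` with its lowest digit
first. -/
def increment : Cmd Var :=
  carry ≔ 1 ;; forTo t len incrementDigit

/-- Place the tuple, the buffer and the working copy behind the table. The assignment to `len`
is `min k m`, written with truncated subtraction. -/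
def layOut : Cmd Var :=
  width ≔ n + 2 ;; cols ≔ n + 1 ;; size ≔ 0 ;; addMul size m width ;; len ≔ k - (k - m) ;;
    digits ≔ src + size ;; buf ≔ digits + len ;; work ≔ buf + width

/-- Start with the tuple of zeros. -/
def clearDigits : Cmd Var :=
  forTo t len (store (digits + t) 0)

/-- Compute the number `m ^ len` of the tuples. -/
def countTuples : Cmd Var :=
  count ≔ 1 ;; rep len (acc ≔ 0 ;; addMul acc m count ;; count ≔ acc)

/-- The initialization of the search. -/
def prepare : Cmd Var :=
  clearDigits ;; countTuples ;; found ≔ 0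

/-- Try all tuples of `min k m` equations. -/
def search : Cmd Var :=
  layOut ;; prepare ;; rep count (trial ;; increment) ;; io ≔ found

end Programs

section Tables

variable {n m : ℕ}

/-- An equation with a weight is kept in `n + 2` consecutive cells: the coefficients, the
right-hand side and the weight. This is the content of cell `c`. -/
def Eqn.word (e : Eqn (Fin n)) (w c : ℕ) : ℕ :=
  if h : c < n then (e.1 ⟨c, h⟩).val else if c = n then e.2.val else w

/-- The cells from `a` on hold the equation `e` with the weight `w`. -/
def HoldsRow (μ : ℕ → ℕ) (a : ℕ) (e : Eqn (Fin n)) (w : ℕ) : Prop :=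
  ∀ c < n + 2, μ (a + c) = e.word w c

/-- The cells from `a` on hold the equations `M` with the weights `w`, row after row. -/
def HoldsTable (μ : ℕ → ℕ) (a : ℕ) (M : Fin m → Eqn (Fin n)) (w : Fin m → ℕ) : Prop :=
  ∀ j : Fin m, HoldsRow μ (a + j * (n + 2)) (M j) (w j)

variable {μ μ' : ℕ → ℕ} {a a' : ℕ} {e f : Eqn (Fin n)} {v : ℕ} {M : Fin m → Eqn (Fin n)}
  {w : Fin m → ℕ}

lemma HoldsRow.coeff (h : HoldsRow μ a e v) (c : Fin n) : μ (a + c) = (e.1 c).val := by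
  rw [h c (by omega), Eqn.word, dif_pos c.2]

lemma HoldsRow.rhs (h : HoldsRow μ a e v) : μ (a + n) = e.2.val := by
  rw [h n (by omega), Eqn.word, dif_neg (lt_irrefl n), if_pos rfl]

lemma Eqn.word_weight (e : Eqn (Fin n)) (u : ℕ) : e.word u (n + 1) = u := by
  rw [word, dif_neg (by omega), if_neg (by omega)]

lemma HoldsRow.weight (h : HoldsRow μ a e v) : μ (a + (n + 1)) = v := by
  rw [h (n + 1) (by omega), Eqn.word_weight]

lemma HoldsRow.congr (h : HoldsRow μ a e v) (heq : ∀ c < n + 2, μ' (a + c) = μ (a + c)) :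
    HoldsRow μ' a e v := fun c hc => (heq c hc).trans (h c hc)

lemma row_end_le {i j : ℕ} (hij : i < j) (n : ℕ) : i * (n + 2) + (n + 2) ≤ j * (n + 2) := by
  rw [← Nat.succ_mul]
  exact Nat.mul_le_mul_right _ hij

lemma HoldsTable.copy (h : HoldsTable μ a M w)
    (heq : ∀ q < m * (n + 2), μ' (a' + q) = μ (a + q)) : HoldsTable μ' a' M w := fun j c _ => by
  have := row_end_le j.2 n
  rw [add_assoc, heq _ (by omega), ← add_assoc, h j c ‹_›]

lemma HoldsTable.congr (h : HoldsTable μ a M w)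
    (heq : ∀ q < a + m * (n + 2), μ' q = μ q) : HoldsTable μ' a M w :=
  h.copy fun _ hq => heq _ (by omega)

lemma HoldsTable.update (h : HoldsTable μ a M w) {i : Fin m}
    (row : HoldsRow μ' (a + i * (n + 2)) e (w i))
    (before : ∀ q < a + i * (n + 2), μ' q = μ q)
    (after : ∀ q, a + i * (n + 2) + (n + 2) ≤ q → μ' q = μ q) :
    HoldsTable μ' a (Function.update M i e) w := fun j => by
  rcases lt_trichotomy j i with hji | rfl | hij
  · rw [Function.update_of_ne hji.ne]
    have := row_end_le hji n
    exact (h j).congr fun c _ => before _ (by omega)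
  · rwa [Function.update_self]
  · rw [Function.update_of_ne hij.ne']
    have := row_end_le hij n
    exact (h j).congr fun c _ => after _ (by omega)

lemma zmod_two_val_add (x y : ZMod 2) : (x + y).val = (x.val - y.val) + (y.val - x.val) := by
  revert x y; decide

lemma Eqn.word_add (e f : Eqn (Fin n)) {u v c : ℕ} (hc : c < n + 1) :
    (e + f).word u c = (e.word u c - f.word v c) + (f.word v c - e.word u c) := by
  rcases Nat.lt_succ_iff_lt_or_eq.mp hc with h | rfl
  · simp [word, h, zmod_two_val_add]
  · simp [word, zmod_two_val_add]

lemma zmod_two_val_pos {x : ZMod 2} : 0 < x.val ↔ x ≠ 0 := by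
  revert x; decide

end Tables

section RowLoops

open Cmd

variable {σ : Env Var} {body : Cmd Var}

lemma run_forRows_induction {I : ℕ → Env Var → Prop}
    (hbody : ∀ x ∈ [.i, .row, .m, .width], x ∉ body.writes)
    (zero : I 0 ((σ.set .row (σ.val .work)).set .i 0))
    (succ : ∀ j < σ.val .m, ∀ τ, τ.val .i = j → τ.val .row = σ.val .work + j * σ.val .width →
      (∀ x ∉ (forRows body).writes, τ.val x = σ.val x) → I j τ →
      I (j + 1) (((body.run τ).set .row (σ.val .work + (j + 1) * σ.val .width)).set .i (j + 1))) :
    I (σ.val .m) ((forRows body).run σ) := by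
  have unchanged {x} (hx : x ∈ [.i, .row, .m, .width]) (τ) : (body.run τ).val x = τ.val x :=
    run_val (hbody x hx)
  have start_m : (σ.set .row (σ.val .work)).val .m = σ.val .m := by simp
  refine start_m ▸ (run_forTo_induction (i := .i) (y := .m) (σ := σ.set .row (σ.val .work))
    (I := fun j τ => τ.val .row = σ.val .work + j * σ.val .width ∧ I j τ)
    (by decide) (by simpa [writes] using hbody .i (by simp)) ⟨by simp, zero⟩
    fun j hj τ val_i frame ⟨val_row, inv⟩ => ?_).2
  have frame' (x) (hx : x ∉ (forRows body).writes) : τ.val x = σ.val x := by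
    simp only [forRows, writes, List.mem_append, List.mem_singleton, not_or] at hx
    rw [frame x hx.2, Env.val_set_of_ne _ _ _ hx.1]
  have val_width : τ.val .width = σ.val .width :=
    frame' _ (by simpa [forRows, forTo, writes] using hbody .width (by simp))
  have run_eq : (body ;; .row ≔ .var .row + .var .width).run τ =
      (body.run τ).set .row (σ.val .work + (j + 1) * σ.val .width) := by
    simp only [run_seq, run_assign, Expr.eval_add, Expr.eval_var]
    rw [unchanged (by simp), unchanged (by simp), val_row, val_width]
    congr 1
    ring
  rw [run_eq]
  exact ⟨by simp, succ j (start_m ▸ hj) τ val_i val_row frame' inv⟩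

end RowLoops

section StepSpec

open Cmd

/-- The memory of the search program: the table from `src` on, one digit for every elimination
step, a buffer for one row and a working copy of the table. -/
structure Layout (n m k : ℕ) (σ : Env Var) : Prop where
  val_n : σ.val .n = n
  val_m : σ.val .m = m
  val_k : σ.val .k = k
  val_width : σ.val .width = n + 2
  val_cols : σ.val .cols = n + 1
  val_size : σ.val .size = m * (n + 2)
  val_len : σ.val .len = min k m
  val_digits : σ.val .digits = σ.val .src + m * (n + 2)
  val_buf : σ.val .buf = σ.val .digits + min k m
  val_work : σ.val .work = σ.val .buf + (n + 2)

/-- The variables that `Layout` speaks about. -/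
def layoutVars : List Var := [.n, .m, .k, .src, .width, .cols, .size, .len, .digits, .buf, .work]

variable {n m k : ℕ} {σ τ : Env Var} {M : Fin m → Eqn (Fin n)} {w : Fin m → ℕ} {i j : Fin m}
  {e f : Eqn (Fin n)} {u v : ℕ}

lemma Layout.congr (h : Layout n m k σ) (heq : ∀ x ∈ layoutVars, τ.val x = σ.val x) :
    Layout n m k τ := by
  simp only [layoutVars, List.forall_mem_cons] at heq
  obtain ⟨hn, hm, hk, hsrc, hwidth, hcols, hsize, hlen, hdigits, hbuf, hwork, -⟩ := heq
  constructor <;> simp only [hn, hm, hk, hsrc, hwidth, hcols, hsize, hlen, hdigits, hbuf, hwork,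
    h.val_n, h.val_m, h.val_k, h.val_width, h.val_cols, h.val_size, h.val_len, h.val_digits,
    h.val_buf, h.val_work]

lemma differ_pos_iff (x y : Expr Var) : 0 < (differ x y).eval σ ↔ x.eval σ ≠ y.eval σ := by
  simp only [differ, Expr.eval_add, Expr.eval_sub]
  omega

lemma fetch_mem (h : Layout n m k σ) (table : HoldsTable σ.mem (σ.val .work) M w)
    (chosen : σ.val .chosen = j) :
    (fetch.run σ).mem = fill σ.mem (σ.val .buf) (n + 2) ((M j).word (w j)) := by
  have inv := run_forRows_induction (σ := σ)
    (body := branch (differ Var.i Var.chosen) skip (copyCells .c .width .buf .row))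
    (I := fun i τ => τ.mem = if j < i then
      fill σ.mem (σ.val .buf) (n + 2) ((M j).word (w j)) else σ.mem) (by decide) (by simp)
    fun i hi τ val_i val_row frame inv => ?_
  · rwa [h.val_m, if_pos j.2] at inv
  have val_chosen : τ.val .chosen = j := (frame _ (by decide)).trans chosen
  simp only [Env.mem_set, run_branch, differ_pos_iff, Expr.eval_var, val_i, val_chosen]
  split_ifs with hne hlt hlt
  · rw [run_skip, inv, if_pos (by omega)]
  · rw [run_skip, inv, if_neg (by omega)]
  · have val_buf : τ.val .buf = σ.val .buf := frame _ (by decide)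
    have val_width : τ.val .width = n + 2 := (frame _ (by decide)).trans h.val_width
    have := h.val_work
    obtain rfl : j = i := by omega
    rw [if_neg (by omega)] at inv
    rw [run_copyCells_mem (by decide) (by decide) (by decide) (by omega), val_buf, val_width, inv,
      val_row, h.val_width]
    exact fill_congr (table j)
  · omega

/-- `l` is one plus the index of the last variable of `e`, or `0` if there is none; only the
variables with an index less than `c` have been examined. -/
def Eqn.IsLast (e : Eqn (Fin n)) (c l : ℕ) : Prop :=
  (l = 0 ∨ ∃ p, e.1 p ≠ 0 ∧ l = p + 1) ∧ ∀ p : Fin n, p < c → e.1 p ≠ 0 → p < l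

lemma Eqn.IsLast.eq_zero_iff {l : ℕ} (h : e.IsLast n l) : l = 0 ↔ e.1 = 0 := by
  refine ⟨fun hl => funext fun p => ?_, fun he => h.1.resolve_right ?_⟩
  · by_contra hp
    exact absurd (h.2 p p.2 hp) (by omega)
  · simp [he]

lemma Eqn.IsLast.exists_step_eq_elim {l : ℕ} (h : (M j).IsLast n l) (hl : 0 < l) :
    ∃ p : Fin n, l = p + 1 ∧ step M j = elim M j p := by
  obtain ⟨p, hp, rfl⟩ := h.1.resolve_left hl.ne'
  have hp : p ∈ (M j).support := by simpa [Eqn.support] using hp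
  have max_eq : (M j).support.max' ⟨p, hp⟩ = p :=
    le_antisymm (Finset.max'_le _ _ _ fun q hq =>
      Nat.lt_succ_iff.mp (h.2 q q.2 (by simpa [Eqn.support] using hq))) (Finset.le_max' _ p hp)
  exact ⟨p, rfl, (dif_pos ⟨p, hp⟩).trans (by rw [max_eq])⟩

lemma Eqn.isLast_succ_self {c : ℕ} (hc : c < n) (occurs : e.1 ⟨c, hc⟩ ≠ 0) :
    e.IsLast (c + 1) (c + 1) :=
  ⟨.inr ⟨_, occurs, rfl⟩, fun _ hp _ => hp⟩

lemma Eqn.IsLast.succ {c l : ℕ} (h : e.IsLast c l) (hc : c < n) (absent : e.1 ⟨c, hc⟩ = 0) :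
    e.IsLast (c + 1) l := by
  refine ⟨h.1, fun p hp hne => h.2 p (lt_of_le_of_ne (Nat.lt_succ_iff.mp hp) ?_) hne⟩
  rintro rfl
  exact hne absent

lemma findLast_isLast (a : Var) (ha : a ∉ [Var.last, Var.c]) (val_n : σ.val .n = n)
    (row : HoldsRow σ.mem (σ.val a) e v) : e.IsLast n (((findLast a).run σ).val .last) := by
  simp only [List.mem_cons, List.not_mem_nil, or_false, not_or] at ha
  have inv := run_forTo_induction (σ := σ.set .last 0) (i := .c) (y := .n)
    (c := branch (.deref (.var a + .var .c)) (.last ≔ .var .c + 1) skip)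
    (I := fun c τ => τ.mem = σ.mem ∧ e.IsLast c (τ.val .last)) (by decide) (by simp [writes])
    (by simp [Eqn.IsLast]) fun c hc τ val_c frame ⟨mem_eq, inv⟩ => ?_
  · simpa [val_n, findLast] using inv.2
  have hc : c < n := by simpa [val_n] using hc
  have val_a : τ.val a = σ.val a := by
    rw [frame a (by simp [forTo, writes, ha]), Env.val_set_of_ne _ _ _ ha.1]
  simp only [run_branch, Expr.eval_deref, Expr.eval_add, Expr.eval_var, val_a, val_c, mem_eq,
    row.coeff ⟨c, hc⟩, zmod_two_val_pos]
  split_ifs with occurs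
  · simpa [mem_eq, val_c] using Eqn.isLast_succ_self hc occurs
  · simpa [mem_eq] using inv.succ hc (not_not.mp occurs)

lemma addBuffer_mem (h : Layout n m k σ) (row : HoldsRow σ.mem (σ.val .row) e u)
    (buf : HoldsRow σ.mem (σ.val .buf) f v) (disj : σ.val .buf + (n + 2) ≤ σ.val .row) :
    (addBuffer.run σ).mem = fill σ.mem (σ.val .row) (n + 1) ((e + f).word u) := by
  rw [← h.val_cols]
  refine run_forTo_store (by decide) fun c hc τ val_c frame mem_eq => ?_
  rw [h.val_cols] at hc
  simp only [differ, Expr.eval_add, Expr.eval_sub, Expr.eval_deref, Expr.eval_var, val_c,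
    frame .row (by decide), frame .buf (by decide), true_and]
  rw [mem_eq, fill_of_le _ _ le_rfl, fill_of_lt _ _ (by omega), row c (by omega), buf c (by omega),
    Eqn.word_add e f hc]

lemma addBuffer_holdsRow (h : Layout n m k σ) (row : HoldsRow σ.mem (σ.val .row) e u)
    (buf : HoldsRow σ.mem (σ.val .buf) f v) (disj : σ.val .buf + (n + 2) ≤ σ.val .row) :
    HoldsRow (addBuffer.run σ).mem (σ.val .row) (e + f) u := fun c hc => by
  rw [addBuffer_mem h row buf disj]
  rcases Nat.lt_succ_iff_lt_or_eq.mp hc with hc | rfl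
  · exact fill_add _ _ hc
  · rw [fill_of_le _ _ le_rfl, row.weight, Eqn.word_weight]

lemma elim_apply_eq_ite (M : Fin m → Eqn (Fin n)) (j : Fin m) (p : Fin n) (i : Fin m) :
    elim M j p i = if (M i).1 p ≠ 0 then M i + M j else M i := by
  split_ifs with h
  · rw [elim, zmod_two_eq_one h, one_smul]
  · rw [elim, not_not.mp h, zero_smul, add_zero]

lemma eliminateRow_holdsRow {p : Fin n} (h : Layout n m k σ)
    (row : HoldsRow σ.mem (σ.val .row) (M i) (w i)) (buf : HoldsRow σ.mem (σ.val .buf) (M j) v)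
    (disj : σ.val .buf + (n + 2) ≤ σ.val .row) (last : σ.val .last = p + 1) :
    HoldsRow (eliminateRow.run σ).mem (σ.val .row) (elim M j p i) (w i) ∧
      ∀ q, q < σ.val .row ∨ σ.val .row + (n + 2) ≤ q → (eliminateRow.run σ).mem q = σ.mem q := by
  have hp : σ.val .row + (p + 1) - 1 = σ.val .row + p := by omega
  simp only [eliminateRow, run_branch, Expr.eval_deref, Expr.eval_sub, Expr.eval_add,
    Expr.eval_var, Expr.eval_ofNat, last, hp, row.coeff p, zmod_two_val_pos, elim_apply_eq_ite]
  split_ifs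
  · refine ⟨addBuffer_holdsRow h row buf disj, fun q hq => ?_⟩
    rw [addBuffer_mem h row buf disj]
    rcases hq with hq | hq
    exacts [fill_of_lt _ _ hq, fill_of_le _ _ (by omega)]
  · exact ⟨row, fun _ _ => rfl⟩

/-- The system in which the elimination of the variable `p` has reached the row `i`. -/
def elimBefore (M : Fin m → Eqn (Fin n)) (j : Fin m) (p : Fin n) (i : ℕ) (i' : Fin m) :
    Eqn (Fin n) :=
  if i' < i then elim M j p i' else M i'

lemma elimBefore_zero (M : Fin m → Eqn (Fin n)) (j : Fin m) (p : Fin n) :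
    elimBefore M j p 0 = M := by
  ext1; simp [elimBefore]

lemma elimBefore_self (M : Fin m → Eqn (Fin n)) (j : Fin m) (p : Fin n) :
    elimBefore M j p m = elim M j p := by
  ext1; simp [elimBefore]

lemma elimBefore_succ (M : Fin m → Eqn (Fin n)) (j : Fin m) (p : Fin n) (i : Fin m) :
    elimBefore M j p (i + 1) = Function.update (elimBefore M j p i) i (elim M j p i) := by
  ext1 i'
  rcases eq_or_ne i' i with rfl | hne
  · simp [elimBefore]
  · have : (i' : ℕ) < i + 1 ↔ (i' : ℕ) < i := by omega
    simp only [elimBefore, Function.update_of_ne hne, this]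

lemma eliminate_holdsTable {p : Fin n} (h : Layout n m k σ)
    (table : HoldsTable σ.mem (σ.val .work) M w) (buf : HoldsRow σ.mem (σ.val .buf) (M j) v)
    (last : σ.val .last = p + 1) :
    HoldsTable (eliminate.run σ).mem (σ.val .work) (elim M j p) w ∧
      ∀ q < σ.val .work, (eliminate.run σ).mem q = σ.mem q := by
  have hwork := h.val_work
  have inv := run_forRows_induction (σ := σ) (body := eliminateRow)
    (I := fun i τ => HoldsTable τ.mem (σ.val .work) (elimBefore M j p i) w ∧
      ∀ q < σ.val .work, τ.mem q = σ.mem q) (by decide)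
    ⟨by rwa [elimBefore_zero], fun _ _ => rfl⟩ fun i hi τ _ val_row frame ⟨table', below⟩ => ?_
  · rwa [h.val_m, elimBefore_self] at inv
  obtain ⟨i, rfl⟩ : ∃ i' : Fin m, i = i' := ⟨⟨i, h.val_m ▸ hi⟩, rfl⟩
  have val_buf : τ.val .buf = σ.val .buf := frame _ (by decide)
  rw [h.val_width] at val_row
  obtain ⟨row', outside⟩ := eliminateRow_holdsRow (σ := τ) (i := i) (p := p) (v := v)
    (h.congr fun x hx => frame x (by revert x; decide))
    (by simpa [elimBefore, val_row] using table' i)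
    (val_buf ▸ buf.congr fun c _ => below _ (by omega)) (by omega)
    ((frame _ (by decide)).trans last)
  rw [val_row] at row' outside
  rw [elimBefore_succ]
  exact ⟨table'.update row' (fun q hq => outside q (.inl hq)) fun q hq => outside q (.inr hq),
    fun q hq => (outside q (.inl (by omega))).trans (below q hq)⟩

end StepSpec

section TrialSpec

open Cmd

variable {n m k : ℕ} {σ τ : Env Var} {M : Fin m → Eqn (Fin n)} {w : Fin m → ℕ} {i j : Fin m}
  {e : Eqn (Fin n)} {v : ℕ}

lemma choose_mem (h : Layout n m k σ) (table : HoldsTable σ.mem (σ.val .work) M w)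
    (digit : σ.mem (σ.val .digits + σ.val .t) = j) :
    (choose.run σ).mem = fill σ.mem (σ.val .buf) (n + 2) ((M j).word (w j)) := by
  rw [choose, run_seq, run_seq, run_mem (by decide)]
  exact fetch_mem (h.congr fun x hx => run_val (by revert x; decide)) (by simpa) (by simpa)

lemma choose_isLast (h : Layout n m k σ) (table : HoldsTable σ.mem (σ.val .work) M w)
    (digit : σ.mem (σ.val .digits + σ.val .t) = j) :
    (M j).IsLast n ((choose.run σ).val .last) := by
  set c : Cmd Var := .chosen ≔ .deref (.var .digits + .var .t) ;; fetch
  have mem_eq : (c.run σ).mem = (choose.run σ).mem :=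
    (run_mem (c := findLast .buf) (by decide)).symm
  have val_n : (c.run σ).val .n = n := (run_val (by decide)).trans h.val_n
  have val_buf : (c.run σ).val .buf = σ.val .buf := run_val (by decide)
  have row : HoldsRow (c.run σ).mem ((c.run σ).val .buf) (M j) (w j) := fun q hq => by
    rw [mem_eq, choose_mem h table digit, val_buf, fill_add _ _ hq]
  exact findLast_isLast .buf (by decide) val_n row

lemma elimStep_holdsTable (h : Layout n m k σ) (table : HoldsTable σ.mem (σ.val .work) M w)
    (digit : σ.mem (σ.val .digits + σ.val .t) = j) :
    HoldsTable (elimStep.run σ).mem (σ.val .work) (step M j) w ∧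
      ∀ q < σ.val .buf, (elimStep.run σ).mem q = σ.mem q := by
  have hwork := h.val_work
  have val_eq (x : Var) (hx : x ∈ layoutVars) : (choose.run σ).val x = σ.val x :=
    run_val (by revert x; decide)
  have isLast := choose_isLast h table digit
  have mem_eq := choose_mem h table digit
  have buf : HoldsRow (choose.run σ).mem (σ.val .buf) (M j) (w j) := fun c hc => by
    rw [mem_eq, fill_add _ _ hc]
  have table' : HoldsTable (choose.run σ).mem (σ.val .work) M w :=
    table.copy fun q _ => by rw [mem_eq, fill_of_le _ _ (by omega)]
  have below (q) (hq : q < σ.val .buf) : (choose.run σ).mem q = σ.mem q := by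
    rw [mem_eq, fill_of_lt _ _ hq]
  rw [elimStep, run_seq, run_branch, Expr.eval_var]
  split_ifs with pos
  · obtain ⟨p, last, step_eq⟩ := isLast.exists_step_eq_elim pos
    have val_work := val_eq .work (by decide)
    have val_buf := val_eq .buf (by decide)
    obtain ⟨table', below'⟩ :=
      eliminate_holdsTable (h.congr val_eq) (val_work ▸ table') (val_buf ▸ buf) last
    rw [step_eq, ← val_work]
    exact ⟨table', fun q hq => (below' q (by omega)).trans (below q hq)⟩
  · rw [step_of_left_eq_zero (isLast.eq_zero_iff.mp (Nat.eq_zero_of_not_pos pos))]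
    exact ⟨table', below⟩

lemma elimSteps_holdsTable (h : Layout n m k σ) (table : HoldsTable σ.mem (σ.val .work) M w)
    {l : List (Fin m)} (length : l.length = min k m)
    (digits : ∀ (t : ℕ) (ht : t < l.length), σ.mem (σ.val .digits + t) = l[t]) :
    HoldsTable ((forTo .t .len elimStep).run σ).mem (σ.val .work) (l.foldl step M) w ∧
      ∀ q < σ.val .buf, ((forTo .t .len elimStep).run σ).mem q = σ.mem q := by
  have hbuf := h.val_buf
  have inv := run_forTo_induction (σ := σ) (i := .t) (y := .len) (c := elimStep)
    (I := fun t τ => HoldsTable τ.mem (σ.val .work) ((l.take t).foldl step M) w ∧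
      ∀ q < σ.val .buf, τ.mem q = σ.mem q) (by decide) (by decide)
    ⟨by simpa using table, fun _ _ => rfl⟩ fun t ht τ val_t frame ⟨table', below⟩ => ?_
  · rwa [h.val_len, ← length, List.take_length] at inv
  rw [h.val_len, ← length] at ht
  have val_eq (x : Var) (hx : x ∈ layoutVars) : τ.val x = σ.val x :=
    frame x (by revert x; decide)
  have val_work := val_eq .work (by decide)
  have digit : τ.mem (τ.val .digits + τ.val .t) = l[t] := by
    rw [val_eq .digits (by decide), val_t, below _ (by omega), digits t ht]
  obtain ⟨table'', below'⟩ := elimStep_holdsTable (h.congr val_eq) (val_work ▸ table') digit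
  rw [val_eq .buf (by decide)] at below'
  rw [← List.take_concat_get' l t ht, List.foldl_concat, ← val_work]
  exact ⟨table'', fun q hq => (below' q hq).trans (below q hq)⟩

lemma sum_ite_lt_succ (g : Fin m → ℤ) (i : Fin m) :
    (∑ i' : Fin m, if i'.val < i.val + 1 then g i' else 0) =
      (∑ i' : Fin m, if i'.val < i.val then g i' else 0) + g i := by
  have split_last (i' : Fin m) : (if i'.val < i.val + 1 then g i' else 0) =
      (if i'.val < i.val then g i' else 0) + if i' = i then g i' else 0 := by
    split_ifs <;> first | omega
  simp only [split_last, Finset.sum_add_distrib, Finset.sum_ite_eq', Finset.mem_univ, if_true]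

lemma evaluateRow_run (val_n : σ.val .n = n) (val_cols : σ.val .cols = n + 1)
    (row : HoldsRow σ.mem (σ.val .row) e v) :
    ((evaluateRow.run σ).val .gain : ℤ) - (evaluateRow.run σ).val .loss =
      σ.val .gain - σ.val .loss + if e.1 = 0 then v * sgn e.2 else 0 := by
  have isLast := findLast_isLast .row (by decide) val_n row
  set τ := (findLast .row).run σ with hτ
  have val_eq (x : Var) (hx : x ∈ [.row, .n, .cols, .gain, .loss]) : τ.val x = σ.val x :=
    run_val (by revert x; decide)
  simp only [List.forall_mem_cons] at val_eq
  obtain ⟨val_row, val_n', val_cols', val_gain, val_loss, -⟩ := val_eq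
  have mem_eq : τ.mem = σ.mem := run_mem (by decide)
  simp only [evaluateRow, run_seq, ← hτ, run_branch, Expr.eval_var, Expr.eval_deref, Expr.eval_add,
    run_skip, run_assign, Nat.pos_iff_ne_zero, isLast.eq_zero_iff.ne, val_row, val_n', val_cols',
    val_gain, val_loss, val_n, val_cols, mem_eq, row.rhs, row.weight, ZMod.val_ne_zero, sgn]
  split_ifs <;> simp_all <;> ring

lemma evaluate_run (h : Layout n m k σ) (table : HoldsTable σ.mem (σ.val .work) M w) :
    ((evaluate.run σ).val .gain : ℤ) - (evaluate.run σ).val .loss = constWeight M w := by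
  set g : Fin m → ℤ := fun i => if (M i).1 = 0 then w i * sgn (M i).2 else 0
  set ρ := (Var.loss ≔ 0).run ((Var.gain ≔ 0).run σ) with hρ
  have val_m : ρ.val .m = m := h.val_m
  have inv := run_forRows_induction (σ := ρ) (body := evaluateRow)
    (I := fun i τ => τ.mem = σ.mem ∧ (τ.val .gain : ℤ) - τ.val .loss =
      ∑ i' : Fin m, if i'.val < i then g i' else 0) (by decide) (by simp [hρ])
    fun i hi τ _ val_row frame ⟨mem_eq, total⟩ => ?_
  · rw [val_m] at inv
    have const : constWeight M w = ∑ i', g i' := by rw [constWeight, Finset.sum_filter]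
    simp only [Fin.is_lt, if_true, ← const] at inv
    exact inv.2
  obtain ⟨i, rfl⟩ : ∃ i' : Fin m, i = i' := ⟨⟨i, val_m ▸ hi⟩, rfl⟩
  have val_row : τ.val .row = σ.val .work + i * (n + 2) := by rw [val_row, ← h.val_width]; rfl
  have row : HoldsRow τ.mem (τ.val .row) (M i) (w i) := by rw [mem_eq, val_row]; exact table i
  have := evaluateRow_run ((frame .n (by decide)).trans h.val_n)
    ((frame .cols (by decide)).trans h.val_cols) row
  refine ⟨(run_mem (by decide)).trans mem_eq, ?_⟩
  rw [sum_ite_lt_succ, ← total]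
  simpa using this

lemma reduce_holdsTable (h : Layout n m k σ) (table : HoldsTable σ.mem (σ.val .src) M w)
    {l : List (Fin m)} (length : l.length = min k m)
    (digits : ∀ (t : ℕ) (ht : t < l.length), σ.mem (σ.val .digits + t) = l[t]) :
    HoldsTable (reduce.run σ).mem (σ.val .work) (l.foldl step M) w ∧
      ∀ q < σ.val .buf, (reduce.run σ).mem q = σ.mem q := by
  have hsize := h.val_size
  have hdigits := h.val_digits
  have hbuf := h.val_buf
  have hwork := h.val_work
  set τ := (copyCells Var.c .size .work .src).run σ
  have val_eq (x : Var) (hx : x ∈ layoutVars) : τ.val x = σ.val x :=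
    run_val (by revert x; decide)
  have val_work := val_eq .work (by decide)
  have mem_eq : τ.mem = fill σ.mem (σ.val .work) (σ.val .size) fun c => σ.mem (σ.val .src + c) :=
    run_copyCells_mem (by decide) (by decide) (by decide) (by omega)
  have table' : HoldsTable τ.mem (τ.val .work) M w :=
    table.copy fun q hq => by rw [mem_eq, val_work, fill_add _ _ (by omega)]
  have below (q) (hq : q < σ.val .work) : τ.mem q = σ.mem q := by
    rw [mem_eq, fill_of_lt _ _ hq]
  obtain ⟨table'', below'⟩ := elimSteps_holdsTable (h.congr val_eq) table' length fun t ht => by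
    rw [val_eq .digits (by decide), below _ (by omega), digits t ht]
  rw [val_work, val_eq .buf (by decide)] at *
  exact ⟨table'', fun q hq => (below' q hq).trans (below q (by omega))⟩

lemma trial_run (h : Layout n m k σ) (table : HoldsTable σ.mem (σ.val .src) M w)
    {l : List (Fin m)} (length : l.length = min k m)
    (digits : ∀ (t : ℕ) (ht : t < l.length), σ.mem (σ.val .digits + t) = l[t]) :
    (trial.run σ).val .found = (if (k : ℤ) ≤ constWeight (l.foldl step M) w then 1
      else σ.val .found) ∧ ∀ q < σ.val .buf, (trial.run σ).mem q = σ.mem q := by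
  obtain ⟨table', below⟩ := reduce_holdsTable h table length digits
  have val_eq (x : Var) (hx : x ∈ layoutVars) : (reduce.run σ).val x = σ.val x :=
    run_val (by revert x; decide)
  have total := evaluate_run (h.congr val_eq) (val_eq .work (by decide) ▸ table')
  set τ := evaluate.run (reduce.run σ) with hτ
  have val_k : τ.val .k = k := (run_val (c := reduce ;; evaluate) (by decide)).trans h.val_k
  have val_found : τ.val .found = σ.val .found := run_val (c := reduce ;; evaluate) (by decide)
  have mem_eq : τ.mem = (reduce.run σ).mem := run_mem (by decide)
  have answer : 0 < τ.val .gain + 1 - (τ.val .loss + k) ↔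
      (k : ℤ) ≤ constWeight (l.foldl step M) w := by omega
  simp only [trial, run_seq, ← hτ, run_branch, Expr.eval_sub, Expr.eval_add, Expr.eval_var,
    Expr.eval_ofNat, val_k, answer]
  split_ifs
  · simpa [mem_eq] using below
  · simpa [mem_eq, val_found] using below

end TrialSpec

section SearchSpec

open Cmd

variable {n m k : ℕ} {σ : Env Var} {M : Fin m → Eqn (Fin n)} {w : Fin m → ℕ}

/-- The cells from `a` on hold the last `len` digits of `N` in base `m`, least significant digit
first. -/
def HoldsDigits (μ : ℕ → ℕ) (a m len N : ℕ) : Prop :=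
  ∀ t < len, μ (a + t) = N / m ^ t % m

/-- The carry into digit `t` when `1` is added to `N` in base `m`. -/
def carryAt (m N t : ℕ) : ℕ := if m ^ t ∣ N + 1 then 1 else 0

lemma succ_div_pow (m N t : ℕ) : (N + 1) / m ^ t = N / m ^ t + carryAt m N t :=
  Nat.succ_div

lemma succ_div_pow_mod (m N t : ℕ) (hm : 0 < m) : (N + 1) / m ^ t % m =
    if N / m ^ t % m + carryAt m N t < m then N / m ^ t % m + carryAt m N t else 0 := by
  have := Nat.mod_lt (N / m ^ t) hm
  have carry_le : carryAt m N t ≤ 1 := by unfold carryAt; split_ifs <;> omega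
  rw [succ_div_pow, ← Nat.mod_add_mod]
  split_ifs with h
  · exact Nat.mod_eq_of_lt h
  · rw [show N / m ^ t % m + carryAt m N t = m by omega, Nat.mod_self]

lemma carryAt_succ (m N t : ℕ) (hm : 0 < m) :
    carryAt m N (t + 1) = if N / m ^ t % m + carryAt m N t < m then 0 else 1 := by
  have hdvd : m ^ (t + 1) ∣ N + 1 ↔ m ^ t ∣ N + 1 ∧ m ∣ (N + 1) / m ^ t := by
    rw [pow_succ, and_congr_right fun h => Nat.dvd_div_iff_mul_dvd h]
    exact (and_iff_right_of_imp dvd_of_mul_right_dvd).symm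
  have := Nat.mod_lt (N / m ^ t) hm
  simp only [carryAt, hdvd, Nat.dvd_iff_mod_eq_zero (n := (N + 1) / m ^ t),
    succ_div_pow_mod m N t hm]
  by_cases h : m ^ t ∣ N + 1 <;> simp only [h, true_and, false_and, if_true, if_false]
  all_goals split_ifs <;> omega

lemma increment_mem {N : ℕ} (h : Layout n m k σ)
    (digits : HoldsDigits σ.mem (σ.val .digits) m (min k m) N) :
    (increment.run σ).mem =
      fill σ.mem (σ.val .digits) (min k m) fun t => (N + 1) / m ^ t % m := by
  have inv := run_forTo_induction (σ := (Var.carry ≔ 1).run σ) (i := .t) (y := .len)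
    (c := incrementDigit)
    (I := fun t τ => τ.mem = fill σ.mem (σ.val .digits) t (fun t => (N + 1) / m ^ t % m) ∧
      τ.val .carry = carryAt m N t) (by decide) (by decide)
    (by simp [fill_zero, carryAt]) fun t ht τ val_t frame ⟨mem_eq, carry⟩ => ?_
  · have val_len : ((Var.carry ≔ 1).run σ).val .len = min k m := h.val_len
    exact (val_len ▸ inv).1
  have ht : t < min k m := h.val_len ▸ ht
  have hm : 0 < m := by omega
  have val_digits : τ.val .digits = σ.val .digits := frame _ (by decide)
  have val_m : τ.val .m = m := (frame _ (by decide)).trans h.val_m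
  have old : τ.mem (σ.val .digits + t) = N / m ^ t % m := by
    rw [mem_eq, fill_of_le _ _ le_rfl, digits t ht]
  have no_overflow : 0 < m - (N / m ^ t % m + carryAt m N t) ↔
      N / m ^ t % m + carryAt m N t < m := Nat.sub_pos_iff_lt
  rw [fill_succ, ← mem_eq, succ_div_pow_mod m N t hm, carryAt_succ m N t hm]
  simp only [incrementDigit, run_seq, run_branch, run_assign, run_store, Expr.eval_add,
    Expr.eval_sub, Expr.eval_var, Expr.eval_deref, val_digits, val_t, old, carry, Env.val_set_self]
  simp only [ne_eq, reduceCtorEq, not_false_eq_true, Env.val_set_of_ne, val_m, no_overflow,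
    Expr.eval_ofNat, Env.mem_set, Env.mem_put, Env.val_put]
  split_ifs <;> simp [val_digits, val_t]

lemma layOut_run (val_n : σ.val .n = n) (val_m : σ.val .m = m) (val_k : σ.val .k = k) :
    Layout n m k (layOut.run σ) := by
  constructor <;> simp (disch := decide) [layOut, val_n, val_m, val_k, run_addMul]
  all_goals omega

lemma clearDigits_mem (h : Layout n m k σ) :
    (clearDigits.run σ).mem = fill σ.mem (σ.val .digits) (min k m) fun _ => 0 :=
  h.val_len ▸ run_forTo_store (by decide) fun j _ τ val_t frame _ => by
    simp [val_t, frame .digits (by decide)]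

lemma countTuples_count : (countTuples.run σ).val .count = σ.val .m ^ σ.val .len := by
  have inv := run_rep_induction (σ := σ.set .count 1) (y := Var.len)
    (c := .acc ≔ 0 ;; addMul .acc .m .count ;; .count ≔ Var.acc)
    (I := fun j τ => τ.val .count = σ.val .m ^ j) (by simp) fun j _ τ frame count => ?_
  · simpa [countTuples] using inv
  have val_m : τ.val .m = σ.val .m := frame .m (by decide)
  simp (disch := decide) [run_addMul, count, val_m, pow_succ']

lemma prepare_run (h : Layout n m k σ) :
    HoldsDigits (prepare.run σ).mem (σ.val .digits) m (min k m) 0 ∧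
      (∀ q < σ.val .digits, (prepare.run σ).mem q = σ.mem q) ∧
      (prepare.run σ).val .count = m ^ min k m ∧ (prepare.run σ).val .found = 0 := by
  have mem_eq : (prepare.run σ).mem = fill σ.mem (σ.val .digits) (min k m) fun _ => 0 :=
    (run_mem (c := countTuples ;; .found ≔ 0) rfl).trans (clearDigits_mem h)
  refine ⟨fun t ht => ?_, fun q hq => ?_, ?_, by simp [prepare]⟩
  · rw [mem_eq, fill_add _ _ ht, Nat.zero_div, Nat.zero_mod]
  · rw [mem_eq, fill_of_lt _ _ hq]
  · have count : (prepare.run σ).val .count = (countTuples.run (clearDigits.run σ)).val .count := by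
      simp [prepare]
    rw [count, countTuples_count, run_val (by decide), run_val (by decide), h.val_m, h.val_len]

/-- The tuple of equations that is tried in round `N`: the digits of `N` in base `m`. -/
def tuple {m len : ℕ} (N : Fin (m ^ len)) : List (Fin m) :=
  List.ofFn (finFunctionFinEquiv.symm N)

lemma exists_tuple_iff {len : ℕ} {P : List (Fin m) → Prop} :
    (∃ N : Fin (m ^ len), P (tuple N)) ↔ ∃ l : List (Fin m), l.length = len ∧ P l := by
  constructor
  · rintro ⟨N, hN⟩
    exact ⟨_, List.length_ofFn, hN⟩
  · rintro ⟨l, rfl, hl⟩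
    exact ⟨finFunctionFinEquiv l.get, by rwa [tuple, Equiv.symm_apply_apply, List.ofFn_get]⟩

/-- The loop invariant of the search: `N` tuples have been tried, and `found` records whether one of
them was successful. -/
structure Searched (n k : ℕ) (M : Fin m → Eqn (Fin n)) (w : Fin m → ℕ) (N : ℕ) (σ : Env Var) :
    Prop where
  layout : Layout n m k σ
  table : HoldsTable σ.mem (σ.val .src) M w
  digits : HoldsDigits σ.mem (σ.val .digits) m (min k m) N
  found : 0 < σ.val .found ↔ ∃ N' : Fin (m ^ min k m), N' < N ∧
    (k : ℤ) ≤ constWeight ((tuple N').foldl step M) w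

lemma searched_zero (h : Layout n m k σ) (table : HoldsTable σ.mem (σ.val .src) M w) :
    Searched n k M w 0 (prepare.run σ) := by
  obtain ⟨digits, below, -, found⟩ := prepare_run h
  have frame (x) (hx : x ∈ layoutVars) : (prepare.run σ).val x = σ.val x :=
    run_val (by revert x; decide)
  refine ⟨h.congr frame, ?_, ?_, by simp [found]⟩
  · rw [frame .src (by decide)]
    exact table.congr fun q hq => below q (h.val_digits ▸ hq)
  · rwa [frame .digits (by decide)]

lemma exists_lt_succ_iff {K N : ℕ} (hN : N < K) {P : Fin K → Prop} :
    (∃ N' : Fin K, N' < N + 1 ∧ P N') ↔ (∃ N' : Fin K, N' < N ∧ P N') ∨ P ⟨N, hN⟩ := by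
  constructor
  · rintro ⟨N', h, hP⟩
    rcases Nat.lt_succ_iff_lt_or_eq.mp h with h | rfl
    exacts [.inl ⟨N', h, hP⟩, .inr hP]
  · rintro (⟨N', h, hP⟩ | hP)
    exacts [⟨N', by omega, hP⟩, ⟨_, N.lt_succ_self, hP⟩]

lemma Searched.round {N : ℕ} (h : Searched n k M w N σ) (hN : N < m ^ min k m) :
    Searched n k M w (N + 1) ((trial ;; increment).run σ) := by
  obtain ⟨layout, table, digits, found⟩ := h
  have val_digits := layout.val_digits
  have val_buf := layout.val_buf
  have frame (x) (hx : x ∈ layoutVars) : (trial.run σ).val x = σ.val x :=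
    run_val (by revert x; decide)
  have frame' (x) (hx : x ∈ .found :: layoutVars) :
      ((trial ;; increment).run σ).val x = (trial.run σ).val x :=
    run_val (c := increment) (by revert x; decide)
  obtain ⟨found', below⟩ := trial_run layout table (l := tuple ⟨N, hN⟩) List.length_ofFn
    fun t ht => by
      simp [digits t (by simpa [tuple] using ht), tuple, finFunctionFinEquiv_symm_apply_val]
  have digits' : HoldsDigits (trial.run σ).mem ((trial.run σ).val .digits) m (min k m) N :=
    fun t ht => by rw [frame .digits (by decide), below _ (by omega), digits t ht]
  have mem_eq : ((trial ;; increment).run σ).mem = fill (trial.run σ).mem (σ.val .digits)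
      (min k m) fun t => (N + 1) / m ^ t % m :=
    frame .digits (by decide) ▸ increment_mem (layout.congr frame) digits'
  have val_eq (x) (hx : x ∈ layoutVars) : ((trial ;; increment).run σ).val x = σ.val x :=
    (frame' x (List.mem_cons_of_mem _ hx)).trans (frame x hx)
  refine ⟨layout.congr val_eq, ?_, fun t ht => ?_, ?_⟩
  · rw [val_eq .src (by decide)]
    exact table.congr fun q hq => by
      rw [mem_eq, fill_of_lt _ _ (by omega), below q (by omega)]
  · rw [val_eq .digits (by decide), mem_eq, fill_add _ _ ht]
  · rw [frame' .found (by decide), found', exists_lt_succ_iff hN]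
    split_ifs with success
    · simp [success]
    · simp [success, found]

lemma search_answer (S : System n m) (val_n : σ.val .n = n) (val_m : σ.val .m = m)
    (val_k : σ.val .k = k) (table : HoldsTable σ.mem (σ.val .src) S.eqns S.w) :
    0 < (search.run σ).val .io ↔ (k : ℤ) ≤ S.maxExcess := by
  have layout := layOut_run val_n val_m val_k
  have table' : HoldsTable (layOut.run σ).mem ((layOut.run σ).val .src) S.eqns S.w := by
    rwa [run_mem rfl, run_val (by decide)]
  have count := (prepare_run layout).2.2.1
  have inv := run_rep_induction (σ := prepare.run (layOut.run σ)) (y := .count)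
    (c := trial ;; increment) (I := Searched n k S.eqns S.w) (searched_zero layout table')
    fun N hN τ _ h => h.round (count ▸ hN)
  rw [System.le_maxExcess_iff, ← exists_tuple_iff]
  rw [count] at inv
  simpa [search] using inv.found

end SearchSpec

section SearchTime

open Cmd

variable {n m k : ℕ} {σ : Env Var} {c : Cmd Var}

/-- The variables of the layout that bound loops. -/
def sizeVars : List Var := [.n, .m, .width, .cols, .size, .len]

lemma Layout.val_le (h : Layout n m k σ) {x : Var} (hx : x ∈ sizeVars) :
    σ.val x ≤ (m + 1) * (n + 2) := by
  revert x
  simp only [sizeVars, List.forall_mem_cons, h.val_n, h.val_m, h.val_width, h.val_cols, h.val_size,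
    h.val_len, List.not_mem_nil, false_imp_iff, implies_true, and_true]
  refine ⟨?_, ?_, ?_, ?_, ?_, ?_⟩ <;> first | nlinarith | (have := min_le_right k m; nlinarith)

/-- An upper bound for all loops of the search except the main one. -/
def searchSize (n m : ℕ) : ℕ := (m + 1) * (n + 2) + 1

lemma one_le_searchSize_pow (n m d : ℕ) : 1 ≤ searchSize n m ^ d :=
  Nat.one_le_pow _ _ (Nat.succ_pos _)

lemma Layout.time_le (h : Layout n m k σ) {d : ℕ} (depth : c.depth ≤ d)
    (bounds : c.bounds ⊆ sizeVars) (writes : ∀ x ∈ sizeVars, x ∉ c.writes) :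
    c.time σ ≤ c.cost * searchSize n m ^ d :=
  (Cmd.time_le (fun x hx => writes x (bounds hx)) fun _ hx => h.val_le (bounds hx)).trans
    (Nat.mul_le_mul_left _ (Nat.pow_le_pow_right (Nat.succ_pos _) depth))

lemma layOut_time_le (val_m : σ.val .m = m) :
    layOut.time σ ≤ layOut.cost * searchSize n m ^ layOut.depth :=
  Cmd.time_le (by decide) fun x hx => by
    obtain rfl : x = .m := by simpa [layOut, addMul, bounds] using hx
    rw [val_m]
    nlinarith

lemma one_le_pow_min (m k : ℕ) : 1 ≤ m ^ min k m := by
  rcases m.eq_zero_or_pos with rfl | hm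
  · simp
  · exact Nat.one_le_pow _ _ hm

lemma search_time_le (val_n : σ.val .n = n) (val_m : σ.val .m = m) (val_k : σ.val .k = k) :
    search.time σ ≤ search.cost * (m ^ min k m * searchSize n m ^ search.depth) := by
  have layout := layOut_run val_n val_m val_k
  have layout' : Layout n m k (prepare.run (layOut.run σ)) :=
    layout.congr fun x hx => run_val (by revert x; decide)
  have time_layOut : layOut.time σ ≤ layOut.cost * searchSize n m ^ search.depth :=
    (layOut_time_le (n := n) val_m).trans (Nat.mul_le_mul_left _
      (Nat.pow_le_pow_right (Nat.succ_pos _) (by decide)))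
  have time_prepare := layout.time_le (c := prepare) (d := search.depth) (by decide) (by decide)
    (by decide)
  have time_round (N : ℕ) : (trial ;; increment).time ((trial ;; increment).run^[N]
      (prepare.run (layOut.run σ))) ≤
        (trial ;; increment).cost * searchSize n m ^ search.depth :=
    (layout'.congr fun x hx => iterate_run_val (fun _ => run_val (by revert x; decide)) N).time_le
      (by decide) (by decide) (by decide)
  have time_loop := time_rep_le .count fun N (_ : N < _) => time_round N
  rw [(prepare_run layout).2.2.1] at time_loop
  have time_eq : search.time σ = layOut.time σ + (prepare.time (layOut.run σ) +
    ((rep .count (trial ;; increment)).time (prepare.run (layOut.run σ)) + 2)) := rfl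
  have cost_eq : search.cost = layOut.cost + (prepare.cost + ((trial ;; increment).cost + 5 + 2)) :=
    rfl
  have one_le_tuples := one_le_pow_min m k
  have one_le_power := one_le_searchSize_pow n m search.depth
  have one_le := Nat.mul_pos one_le_tuples one_le_power
  rw [time_eq, cost_eq]
  generalize searchSize n m ^ search.depth = Z at *
  generalize m ^ min k m = P at *
  nlinarith

end SearchTime

section Machine

variable {x : List ℕ} {q : Prop}

/-- The environment that corresponds to the initial configuration on input `x`. -/
def Env.start (x : List ℕ) : Env Var where
  val v := if v = .io then x.length else 0
  mem i := x.getD i 0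

lemma represents_start (x : List ℕ) :
    Represents Var.ctorIdx (Env.start x) (State.start x) where
  reg v := by
    have : 2 * v.ctorIdx = 0 ↔ v = .io := by cases v <;> decide
    simp only [State.start, Env.start, this]
  mem := rfl

lemma Cmd.answers (c : Cmd Var) (h : 0 < (c.run (Env.start x)).val .io ↔ q) :
    (c.code Var.ctorIdx 0).Answers x (c.time (Env.start x)) q := by
  obtain ⟨s, exec, rep, -⟩ := c.simulates (d := 0) Var.ctorIdx_injective (represents_start x)
  exact ⟨s, exec, by rw [← h, ← rep.reg .io]; rfl⟩

end Machine

section Words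

open Cmd

variable {n m k : ℕ}

lemma getD_flatten_ofFn {R : ℕ} (g : Fin m → List ℕ) (length : ∀ j, (g j).length = R) (j : Fin m)
    {c : ℕ} (hc : c < R) : (List.ofFn g).flatten.getD (j * R + c) 0 = (g j).getD c 0 := by
  induction m with
  | zero => exact j.elim0
  | succ m ih =>
    rw [List.ofFn_succ, List.flatten_cons]
    refine Fin.cases ?_ (fun j => ?_) j
    · rw [Fin.val_zero, Nat.zero_mul, Nat.zero_add, List.getD_append _ _ _ _ (by rwa [length])]
    · have offset : ((j.succ : Fin (m + 1)) : ℕ) * R + c = R + (j * R + c) := by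
        rw [Fin.val_succ]; ring
      rw [offset, List.getD_append_right _ _ _ _ (by rw [length]; omega), length,
        Nat.add_sub_cancel_left, ih _ fun j => length j.succ]

lemma Eqn.getD_eq_word (e : Eqn (Fin n)) (w : ℕ) {c : ℕ} (hc : c < n + 2) :
    ((List.ofFn fun i => (e.1 i).val) ++ [e.2.val, w]).getD c 0 = e.word w c := by
  unfold word
  split_ifs with h h'
  · simp [List.getD_eq_getElem?_getD, h, List.getElem?_append]
  · subst h'
    simp
  · obtain rfl : c = n + 1 := by omega
    simp

lemma System.toWords_holdsTable (S : System n m) (k : ℕ) :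
    HoldsTable (Env.start (k :: S.toWords)).mem 3 S.eqns S.w := fun j c hc => by
  have shift : 3 + j * (n + 2) + c = j * (n + 2) + c + 1 + 1 + 1 := by ring
  rw [← Eqn.getD_eq_word _ _ hc]
  refine Eq.trans ?_ (getD_flatten_ofFn (fun j => (List.ofFn fun i => (S.A j i).val) ++
    [(S.b j).val, S.w j]) (by simp) j hc)
  simp [Env.start, System.toWords, shift]

/-- Read the parameter and the sizes of a system that is given by a list of numbers. -/
def readWordHeader : Cmd Var :=
  .k ≔ .deref 0 ;; .n ≔ .deref 1 ;; .m ≔ .deref 2 ;; .src ≔ 3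

/-- The program for systems that are given by lists of numbers. -/
def solveWords : Cmd Var :=
  readWordHeader ;; search

lemma readWordHeader_run (S : System n m) (k : ℕ) :
    ∃ σ : Env Var, readWordHeader.run (Env.start (k :: S.toWords)) = σ ∧ σ.val .n = n ∧
      σ.val .m = m ∧ σ.val .k = k ∧ HoldsTable σ.mem (σ.val .src) S.eqns S.w := by
  refine ⟨_, rfl, ?_, ?_, ?_, ?_⟩
  · simp [readWordHeader, Env.start, System.toWords]
  · simp [readWordHeader, Env.start, System.toWords]
  · simp [readWordHeader, Env.start]
  · simpa [readWordHeader] using S.toWords_holdsTable k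

lemma solveWords_answer (S : System n m) (k : ℕ) :
    0 < (solveWords.run (Env.start (k :: S.toWords))).val .io ↔ (k : ℤ) ≤ S.maxExcess := by
  obtain ⟨σ, run_eq, val_n, val_m, val_k, table⟩ := readWordHeader_run S k
  rw [solveWords, run_seq, run_eq]
  exact search_answer S val_n val_m val_k table

lemma solveWords_time_le (S : System n m) (k : ℕ) :
    solveWords.time (Env.start (k :: S.toWords)) ≤
      solveWords.cost * (m ^ min k m * searchSize n m ^ search.depth) := by
  obtain ⟨σ, run_eq, val_n, val_m, val_k, -⟩ := readWordHeader_run S k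
  have header : readWordHeader.time (Env.start (k :: S.toWords)) = readWordHeader.cost := rfl
  have one_le := Nat.mul_pos (one_le_pow_min m k) (one_le_searchSize_pow n m search.depth)
  rw [solveWords, time_seq, run_eq, header, cost, add_mul]
  exact Nat.add_le_add (Nat.le_mul_of_pos_right _ one_le) (search_time_le val_n val_m val_k)

lemma System.pos_of_pos (S : System n m) (hm : 0 < m) : 0 < n :=
  (S.row_ne_zero ⟨0, hm⟩).choose.pos

lemma solveWords_time_le_pow (S : System n m) (k : ℕ) (hm : 0 < m) :
    solveWords.time (Env.start (k :: S.toWords)) ≤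
      solveWords.cost * 7 ^ search.depth * (n ^ search.depth * m ^ (k + search.depth)) := by
  have hn := S.pos_of_pos hm
  have size : searchSize n m ≤ 7 * (n * m) := by
    unfold searchSize
    nlinarith
  calc _ ≤ solveWords.cost * (m ^ min k m * searchSize n m ^ search.depth) :=
        solveWords_time_le S k
    _ ≤ solveWords.cost * (m ^ k * (7 * (n * m)) ^ search.depth) := by
      gcongr
      exact min_le_left _ _
    _ = _ := by rw [mul_pow, mul_pow, pow_add]; ring

theorem exists_prog_toWords : ∃ (P : Prog) (C c : ℕ), ∀ (n m k : ℕ) (S : System n m), ∃ t : ℕ,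
    P.Answers (k :: S.toWords) t ((k : ℤ) ≤ S.maxExcess) ∧
      (0 < m → t ≤ C * (n ^ c * m ^ (k + c))) ∧ (0 < m → n ≤ m → t ≤ C * m ^ (k + c)) := by
  set d := search.depth
  refine ⟨solveWords.code Var.ctorIdx 0, solveWords.cost * 7 ^ d, d + d, fun n m k S =>
    ⟨_, solveWords.answers (solveWords_answer S k), fun hm => ?_, fun hm hnm => ?_⟩⟩
  · refine (solveWords_time_le_pow S k hm).trans ?_
    have hn := S.pos_of_pos hm
    gcongr <;> omega
  · calc _ ≤ solveWords.cost * 7 ^ d * (n ^ d * m ^ (k + d)) := solveWords_time_le_pow S k hm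
      _ ≤ solveWords.cost * 7 ^ d * (m ^ d * m ^ (k + d)) := by gcongr
      _ = solveWords.cost * 7 ^ d * m ^ (k + (d + d)) := by rw [← pow_add]; congr 2; omega

end Words

/-! ### Systems as bit strings -/

section Encoding

variable {n m : ℕ}

/-- An equation as it is written in a bit string, together with the digits of its weight, which
need not end with the digit `1`. -/
abbrev RawEqn (n : ℕ) := Eqn (Fin n) × List Bool

/-- The bits by which `System.toBits` represents the coefficients and the right-hand side. -/
def Eqn.bits (e : Eqn (Fin n)) : List Bool :=
  (List.ofFn fun i => decide (e.1 i = 1)) ++ [decide (e.2 = 1)]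

/-- The bits by which `System.toBits` represents the digits of a weight. -/
def digitBits (ds : List Bool) : List Bool :=
  ds.flatMap (fun d => [true, d]) ++ [false]

lemma length_digitBits (ds : List Bool) : (digitBits ds).length = 2 * ds.length + 1 := by
  simp [digitBits, List.length_flatMap, mul_comm]

/-- The bits by which `System.toBits` represents an equation with its weight. -/
def RawEqn.bits (r : RawEqn n) : List Bool :=
  r.1.bits ++ digitBits r.2

/-- The bits by which `System.toBits` represents a number in unary. -/
def unaryBits (N : ℕ) : List Bool :=
  List.replicate N true ++ [false]

/-- Like `System.toBits`, for a sequence of equations that need not form a system. -/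
def rawBits (R : Fin m → RawEqn n) : List Bool :=
  unaryBits n ++ unaryBits m ++ (List.ofFn fun j => (R j).bits).flatten

/-- The weight whose digits are given. -/
def RawEqn.weight (r : RawEqn n) : ℕ :=
  Nat.ofDigits 2 (r.2.map Bool.toNat)

/-- The equation contains a variable, and the digits are those of a positive number, without
leading zeros. -/
def RawEqn.Valid (r : RawEqn n) : Prop :=
  r.1.1 ≠ 0 ∧ r.2.getLastD false = true

lemma map_toNat_bits (w : ℕ) : w.bits.map Bool.toNat = Nat.digits 2 w :=
  (Nat.digits_two_eq_bits w).symm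

lemma getLastD_bits {w : ℕ} (hw : w ≠ 0) : w.bits.getLastD false = true := by
  have getLast_digits := Nat.getLast_digit_ne_zero 2 hw
  simp only [← map_toNat_bits, List.getLast_map, Bool.toNat_eq_zero, ne_eq,
    Bool.not_eq_false] at getLast_digits
  rw [List.getLastD_eq_getLast?, List.getLast?_eq_getLast_of_ne_nil, getLast_digits,
    Option.getD_some]
  exact fun hnil => Nat.digits_ne_nil_iff_ne_zero.mpr hw (by rw [← map_toNat_bits, hnil]; rfl)

lemma bits_ofDigits {ds : List Bool} (h : ds.getLastD false = true) :
    (Nat.ofDigits 2 (ds.map Bool.toNat)).bits = ds := by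
  refine List.map_injective_iff.mpr (show Function.Injective Bool.toNat by decide) ?_
  rw [map_toNat_bits]
  refine Nat.digits_ofDigits 2 one_lt_two _ ?_ fun hne => ?_
  · exact List.forall_mem_map.mpr fun d _ => Bool.toNat_lt d
  · rw [List.getLastD_eq_getLast?, List.getLast?_eq_getLast_of_ne_nil (by simpa using hne),
      Option.getD_some] at h
    rw [List.getLast_map, h]
    exact one_ne_zero

namespace System

/-- The equations of a system with the digits of their weights. -/
def raw (S : System n m) (j : Fin m) : RawEqn n :=
  (S.eqns j, (S.w j).bits)

lemma toBits_eq_rawBits (S : System n m) : S.toBits = rawBits S.raw := by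
  simp only [toBits, rawBits, unaryBits, RawEqn.bits, Eqn.bits, digitBits, raw, eqns,
    List.append_assoc]
  rfl

lemma raw_weight (S : System n m) (j : Fin m) : (S.raw j).weight = S.w j := by
  rw [RawEqn.weight, raw, map_toNat_bits, Nat.ofDigits_digits]

lemma raw_valid (S : System n m) (j : Fin m) : (S.raw j).Valid :=
  ⟨Function.ne_iff.mpr (S.row_ne_zero j), getLastD_bits (S.w_pos j).ne'⟩

end System

lemma exists_system_raw_eq {R : Fin m → RawEqn n} (hR : ∀ j, (R j).Valid) :
    ∃ S : System n m, S.raw = R := by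
  refine ⟨⟨fun j => (R j).1.1, fun j => (R j).1.2, fun j => (R j).weight,
    fun j => Nat.pos_of_ne_zero fun hw => ?_, fun j => Function.ne_iff.mp (hR j).1⟩,
    funext fun j => Prod.ext rfl (bits_ofDigits (hR j).2)⟩
  have bits_eq := bits_ofDigits (hR j).2
  rw [show Nat.ofDigits 2 ((R j).2.map Bool.toNat) = 0 from hw, Nat.zero_bits] at bits_eq
  simpa [← bits_eq] using (hR j).2

end Encoding

section Reading

variable {n m : ℕ} {B : ℕ → Bool} {p : ℕ} {l l' : List Bool}

/-- From position `p` on, the stream `B` begins with the list `l`. -/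
def Reads (B : ℕ → Bool) (p : ℕ) (l : List Bool) : Prop :=
  ∀ i (hi : i < l.length), B (p + i) = l[i]

@[simp] lemma reads_nil : Reads B p [] := fun _ hi => absurd hi (Nat.not_lt_zero _)

lemma reads_append : Reads B p (l ++ l') ↔ Reads B p l ∧ Reads B (p + l.length) l' := by
  refine ⟨fun h => ⟨fun i hi => ?_, fun i hi => ?_⟩, fun ⟨h, h'⟩ i hi => ?_⟩
  · rw [h i (by simp; omega), List.getElem_append_left]
  · rw [add_assoc, h (l.length + i) (by simpa), List.getElem_append_right (by omega)]
    simp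
  · rw [List.getElem_append]
    split_ifs with hil
    · exact h i hil
    · rw [← h' (i - l.length) (by simp at hi; omega)]
      congr 1
      omega

lemma Reads.flatten {ls : List (List Bool)} (h : Reads B p ls.flatten) {i : ℕ}
    (hi : i < ls.length) : Reads B (p + (ls.take i).flatten.length) ls[i] := by
  rw [← List.take_append_drop i ls, List.flatten_append, reads_append] at h
  rw [List.drop_eq_getElem_cons hi, List.flatten_cons, reads_append] at h
  exact h.2.1

@[simp] lemma reads_singleton {b : Bool} : Reads B p [b] ↔ B p = b :=
  ⟨fun h => h 0 Nat.one_pos, fun h i hi => by simpa [Nat.lt_one_iff.mp hi] using h⟩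

lemma reads_cons {b : Bool} : Reads B p (b :: l) ↔ B p = b ∧ Reads B (p + 1) l := by
  rw [← List.singleton_append, reads_append, reads_singleton, List.length_singleton]

lemma reads_ofFn {f : Fin n → Bool} : Reads B p (List.ofFn f) ↔ ∀ i : Fin n, B (p + i) = f i := by
  simp [Reads, Fin.forall_iff]

lemma reads_unaryBits {N : ℕ} :
    Reads B p (unaryBits N) ↔ (∀ i < N, B (p + i) = true) ∧ B (p + N) = false := by
  rw [unaryBits, reads_append, reads_singleton, List.length_replicate]
  simp [Reads]

lemma reads_digitBits {ds : List Bool} : Reads B p (digitBits ds) ↔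
    (∀ j (hj : j < ds.length), B (p + 2 * j) = true ∧ B (p + 2 * j + 1) = ds[j]) ∧
      B (p + 2 * ds.length) = false := by
  induction ds generalizing p with
  | nil => simp [digitBits]
  | cons d ds ih =>
    have unfold_cons : digitBits (d :: ds) = true :: d :: digitBits ds := rfl
    have shift : ∀ j, p + 1 + 1 + 2 * j = p + 2 * (j + 1) := fun j => by ring
    simp only [unfold_cons, reads_cons, ih, shift, List.length_cons, ← and_assoc]
    refine and_congr_left fun _ =>
      ⟨fun ⟨hd, hds⟩ j hj => ?_, fun h => ⟨h 0 (by simp), fun j hj => ?_⟩⟩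
    · cases j with
      | zero => exact hd
      | succ j => exact hds j (by simpa using hj)
    · exact h (j + 1) (by simpa using hj)

lemma exists_reads_unaryBits {L : ℕ} (hB : ∀ p, L ≤ p → B p = false) (p : ℕ) :
    ∃ N, Reads B p (unaryBits N) := by
  have h : ∃ N, B (p + N) = false := ⟨L, hB _ (by omega)⟩
  exact ⟨Nat.find h, reads_unaryBits.mpr ⟨fun i hi => by simpa using Nat.find_min h hi,
    Nat.find_spec h⟩⟩

lemma exists_reads_digitBits {L : ℕ} (hB : ∀ p, L ≤ p → B p = false) (p : ℕ) :
    ∃ ds, Reads B p (digitBits ds) := by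
  have h : ∃ N, B (p + 2 * N) = false := ⟨L, hB _ (by omega)⟩
  refine ⟨List.ofFn fun j : Fin (Nat.find h) => B (p + 2 * j + 1), reads_digitBits.mpr ?_⟩
  simp only [List.length_ofFn, List.getElem_ofFn, and_true]
  exact ⟨fun j hj => by simpa using Nat.find_min h hj, Nat.find_spec h⟩

lemma reads_eqnBits {e : Eqn (Fin n)} : Reads B p e.bits ↔
    (∀ i : Fin n, B (p + i) = decide (e.1 i = 1)) ∧ B (p + n) = decide (e.2 = 1) := by
  rw [Eqn.bits, reads_append, reads_ofFn, reads_singleton, List.length_ofFn]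

lemma exists_reads_eqnBits (B : ℕ → Bool) (p n : ℕ) : ∃ e : Eqn (Fin n), Reads B p e.bits := by
  have toZMod (b : Bool) : b = decide ((if b then 1 else 0 : ZMod 2) = 1) := by cases b <;> rfl
  exact ⟨(fun i => if B (p + i) then 1 else 0, if B (p + n) then 1 else 0),
    reads_eqnBits.mpr ⟨fun i => toZMod _, toZMod _⟩⟩

lemma exists_reads_rows {L : ℕ} (hB : ∀ p, L ≤ p → B p = false) (n m p : ℕ) :
    ∃ R : Fin m → RawEqn n, Reads B p (List.ofFn fun j => (R j).bits).flatten := by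
  induction m generalizing p with
  | zero => exact ⟨Fin.elim0, reads_nil⟩
  | succ m ih =>
    obtain ⟨e, reads_e⟩ := exists_reads_eqnBits B p n
    obtain ⟨ds, reads_ds⟩ := exists_reads_digitBits hB (p + e.bits.length)
    obtain ⟨R, reads_R⟩ := ih (p + (RawEqn.bits (e, ds)).length)
    refine ⟨Fin.cons (e, ds) R, ?_⟩
    rw [List.ofFn_succ, List.flatten_cons, reads_append]
    exact ⟨reads_append.mpr ⟨reads_e, reads_ds⟩, reads_R⟩

lemma exists_reads_rawBits {L : ℕ} (hB : ∀ p, L ≤ p → B p = false) (p : ℕ) :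
    ∃ (n m : ℕ) (R : Fin m → RawEqn n), Reads B p (rawBits R) := by
  obtain ⟨n, reads_n⟩ := exists_reads_unaryBits hB p
  obtain ⟨m, reads_m⟩ := exists_reads_unaryBits hB (p + (unaryBits n).length)
  obtain ⟨R, reads_R⟩ := exists_reads_rows hB n m (p + (unaryBits n ++ unaryBits m).length)
  exact ⟨n, m, R, reads_append.mpr ⟨reads_append.mpr ⟨reads_n, reads_m⟩, reads_R⟩⟩

end Reading

section ReadingPrograms

open Cmd Var

local notation "mem[" e "]" => (Expr.deref e : Expr Var)

/-- Repeat the command `c` until it sets `go` to `0`, but at most as many times as `io` says. -/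
def repWhile (c : Cmd Var) : Cmd Var :=
  go ≔ 1 ;; rep io (branch go c skip)

/-- Read the next bit of the input; `io` is the first address after the input, and beyond it
zeros are read. -/
def readBit : Cmd Var :=
  branch (.var io - .var next) (bit ≔ mem[next]) (bit ≔ 0) ;; next ≔ next + 1

/-- Read a number in unary into the variable `a`. -/
def readUnary (a : Var) : Cmd Var :=
  a ≔ 0 ;; repWhile (readBit ;; branch bit (a ≔ .var a + 1) (go ≔ 0))

/-- Read a binary digit and add it to `weight` at the place given by `place`; `canonical` keeps
the last digit. -/
def readDigit : Cmd Var :=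
  readBit ;; branch bit (weight ≔ weight + place) skip ;; canonical ≔ bit ;;
    place ≔ place + place

/-- Read the binary digits of a weight. -/
def readWeight : Cmd Var :=
  weight ≔ 0 ;; place ≔ 1 ;; canonical ≔ 0 ;;
    repWhile (readBit ;; branch bit readDigit (go ≔ 0))

/-- Read the coefficients and the right-hand side of an equation into the current row. -/
def readCells : Cmd Var :=
  forTo c cols (readBit ;; store (row + c) bit)

/-- Read an equation and its weight into the current row. -/
def readWeightedCells : Cmd Var :=
  readCells ;; readWeight ;; store (row + cols) weight

/-- Set `valid` to `0` if the equation in the current row contains no variable or the digits of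
its weight do not end with `1`. -/
def checkRow : Cmd Var :=
  findLast row ;; branch last (branch canonical skip (valid ≔ 0)) (valid ≔ 0)

/-- Read and check an equation with its weight. -/
def readRow : Cmd Var :=
  readWeightedCells ;; checkRow

variable {σ : Env Var} {B : ℕ → Bool} {N : ℕ} {n m : ℕ}

/-- The memory cells before the address `io`, except for the cell `0`, hold the stream `B`, all of
whose other bits are `false`. -/
structure HoldsBits (σ : Env Var) (B : ℕ → Bool) : Prop where
  io_pos : 0 < σ.val io
  mem : ∀ p, 0 < p → p < σ.val io → σ.mem p = (B p).toNat
  beyond : ∀ p, σ.val io ≤ p → B p = false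

lemma HoldsBits.congr {τ : Env Var} (h : HoldsBits σ B) (val_io : τ.val io = σ.val io)
    (mem_eq : ∀ p < σ.val io, τ.mem p = σ.mem p) : HoldsBits τ B where
  io_pos := val_io ▸ h.io_pos
  mem p hp hlt := (mem_eq p (val_io ▸ hlt)).trans (h.mem p hp (val_io ▸ hlt))
  beyond p hle := h.beyond p (val_io ▸ hle)

lemma HoldsBits.run (h : HoldsBits σ B) {c : Cmd Var} (writes : io ∉ c.writes)
    (stores : c.stores = false) : HoldsBits (c.run σ) B :=
  h.congr (run_val writes) fun _ _ => by rw [run_mem stores]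

@[simp] lemma holdsBits_set {x : Var} (hx : x ≠ io) (a : ℕ) :
    HoldsBits (σ.set x a) B ↔ HoldsBits σ B := by
  have val_io : (σ.set x a).val io = σ.val io := σ.val_set_of_ne _ _ hx.symm
  exact ⟨fun h => h.congr val_io.symm fun _ _ => rfl, fun h => h.congr val_io fun _ _ => rfl⟩

lemma HoldsBits.lt_io (h : HoldsBits σ B) {p : ℕ} (hp : B p = true) : p < σ.val io := by
  by_contra hle
  simp [h.beyond p (not_lt.mp hle)] at hp

lemma run_repWhile_induction {c : Cmd Var} {I : ℕ → Env Var → Prop} {Q : Env Var → Prop}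
    (hN : N < σ.val io) (zero : I 0 (σ.set go 1))
    (succ : ∀ j < N, ∀ τ, 0 < τ.val go → I j τ → 0 < (c.run τ).val go ∧ I (j + 1) (c.run τ))
    (last : ∀ τ, I N τ → (c.run τ).val go = 0 ∧ Q (c.run τ)) : Q ((repWhile c).run σ) := by
  have start_io : (σ.set go 1).val io = σ.val io := by simp
  have inv := run_rep_induction (σ := σ.set go 1) (y := io) (c := branch go c skip)
    (I := fun j τ => if j ≤ N then 0 < τ.val go ∧ I j τ else τ.val go = 0 ∧ Q τ)
    (by simpa using zero) fun j _ τ _ inv => ?_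
  · rw [start_io, if_neg (by omega)] at inv
    exact inv.2
  rw [run_branch, Expr.eval_var]
  rcases lt_trichotomy j N with hj | rfl | hj
  · rw [if_pos hj.le] at inv
    rw [if_pos (show j + 1 ≤ N from hj), if_pos inv.1]
    exact succ j hj τ inv.1 inv.2
  · rw [if_pos le_rfl] at inv
    rw [if_neg (by omega), if_pos inv.1]
    exact last τ inv.2
  · rw [if_neg (by omega)] at inv
    rw [if_neg (by omega), if_neg (by omega)]
    exact inv

lemma readBit_run (h : HoldsBits σ B) (hp : 0 < σ.val next) :
    readBit.run σ = (σ.set bit (B (σ.val next)).toNat).set next (σ.val next + 1) := by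
  have bit_eq : (branch (.var io - .var next) (bit ≔ mem[next]) (bit ≔ 0)).run σ =
      σ.set bit (B (σ.val next)).toNat := by
    rw [run_branch]
    split_ifs with hlt <;> simp only [Expr.eval_sub, Expr.eval_var] at hlt
    · simp only [run_assign, Expr.eval_deref, Expr.eval_var, h.mem _ hp (by omega)]
    · simp only [run_assign, Expr.eval_ofNat, h.beyond _ (show _ ≤ σ.val next by omega),
        Bool.toNat_false]
  rw [readBit, run_seq, bit_eq]
  simp

lemma HoldsBits.unary_lt_io (h : HoldsBits σ B) {p : ℕ} (hp : 0 < p)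
    (reads : Reads B p (unaryBits N)) : N < σ.val io := by
  rcases N.eq_zero_or_pos with rfl | hpos
  · exact h.io_pos
  · have := h.lt_io ((reads_unaryBits.mp reads).1 (N - 1) (by omega))
    omega

lemma readUnary_run {a : Var} (ha : a ∉ [io, next, bit, go]) (h : HoldsBits σ B)
    (hp : 0 < σ.val next) (reads : Reads B (σ.val next) (unaryBits N)) :
    ((readUnary a).run σ).val a = N ∧
      ((readUnary a).run σ).val next = σ.val next + (unaryBits N).length := by
  obtain ⟨ones, zero⟩ := reads_unaryBits.mp reads
  simp only [List.mem_cons, List.not_mem_nil, or_false, not_or] at ha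
  obtain ⟨hio, hnext, hbit, hgo⟩ := ha
  have hN := h.unary_lt_io hp reads
  refine run_repWhile_induction (σ := σ.set a 0) (N := N)
    (I := fun j τ => HoldsBits τ B ∧ τ.val a = j ∧ τ.val next = σ.val next + j)
    (Q := fun τ => τ.val a = N ∧ τ.val next = σ.val next + (unaryBits N).length)
    (by simpa [Ne.symm hio] using hN) ?_ ?_ ?_
  · simp [*, Ne.symm]
  · rintro j hj τ val_go ⟨hB, val_a, val_next⟩
    rw [run_seq, readBit_run hB (by omega), val_next, ones j hj]
    simp [run_branch, *, Ne.symm, add_assoc]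
  · rintro τ ⟨hB, val_a, val_next⟩
    rw [run_seq, readBit_run hB (by omega), val_next, zero]
    simp [run_branch, unaryBits, *, Ne.symm, add_assoc]

/-- The values of `weight`, `place` and `canonical` after the digits `ds` have been read. -/
structure HasReadDigits (ds : List Bool) (σ : Env Var) : Prop where
  val_weight : σ.val weight = Nat.ofDigits 2 (ds.map Bool.toNat)
  val_place : σ.val place = 2 ^ ds.length
  val_canonical : σ.val canonical = (ds.getLastD false).toNat

lemma HasReadDigits.readDigit_run {ds : List Bool} (h : HasReadDigits ds σ) (hB : HoldsBits σ B)
    (hp : 0 < σ.val next) :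
    HasReadDigits (ds ++ [B (σ.val next)]) (readDigit.run σ) ∧
      (readDigit.run σ).val next = σ.val next + 1 := by
  obtain ⟨val_weight, val_place, -⟩ := h
  rw [readDigit, run_seq, readBit_run hB hp]
  refine ⟨⟨?_, ?_, ?_⟩, ?_⟩ <;> cases B (σ.val next) <;>
    simp [run_branch, val_weight, val_place, Nat.ofDigits_append, pow_succ, mul_two]

lemma HoldsBits.digits_length_lt_io {ds : List Bool} (h : HoldsBits σ B) {p : ℕ} (hp : 0 < p)
    (reads : Reads B p (digitBits ds)) : ds.length < σ.val io := by
  rcases Nat.eq_zero_or_pos ds.length with hnil | hpos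
  · exact hnil ▸ h.io_pos
  · have := h.lt_io ((reads_digitBits.mp reads).1 (ds.length - 1) (by omega)).1
    omega

lemma readWeight_run {ds : List Bool} (h : HoldsBits σ B) (hp : 0 < σ.val next)
    (reads : Reads B (σ.val next) (digitBits ds)) :
    HasReadDigits ds (readWeight.run σ) ∧
      (readWeight.run σ).val next = σ.val next + (digitBits ds).length := by
  obtain ⟨digits, zero⟩ := reads_digitBits.mp reads
  refine run_repWhile_induction (σ := ((σ.set weight 0).set place 1).set canonical 0)
    (N := ds.length) (I := fun j τ => HoldsBits τ B ∧ τ.val next = σ.val next + 2 * j ∧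
      HasReadDigits (ds.take j) τ)
    (Q := fun τ => HasReadDigits ds τ ∧ τ.val next = σ.val next + (digitBits ds).length)
    (by simpa using h.digits_length_lt_io hp reads) ?_ ?_ ?_
  · simp [h]
    constructor <;> simp
  · rintro j hj τ val_go ⟨hB, val_next, read⟩
    obtain ⟨one, digit⟩ := digits j hj
    set ρ := (τ.set bit 1).set next (σ.val next + 2 * j + 1)
    have run_eq : (readBit ;; branch bit readDigit (go ≔ 0)).run τ = readDigit.run ρ := by
      rw [run_seq, readBit_run hB (by omega), val_next, one]
      simp [run_branch, ρ]
    have hBρ : HoldsBits ρ B := by simp [ρ, hB]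
    have val_next_ρ : ρ.val next = σ.val next + 2 * j + 1 := by simp [ρ]
    have read_ρ : HasReadDigits (ds.take j) ρ := by
      constructor <;> simp [ρ, read.val_weight, read.val_place, read.val_canonical]
    obtain ⟨read', val_next'⟩ := read_ρ.readDigit_run hBρ (by omega)
    rw [val_next_ρ, digit, List.take_append_getElem hj] at read'
    have val_go' : (readDigit.run ρ).val go = τ.val go := by
      rw [run_val (by decide)]
      simp [ρ]
    rw [run_eq]
    exact ⟨by omega, hBρ.run (by decide) rfl, by omega, read'⟩
  · rintro τ ⟨hB, val_next, val_weight, val_place, val_canonical⟩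
    rw [run_seq, readBit_run hB (by omega), val_next, zero]
    rw [List.take_length] at *
    refine ⟨?_, ⟨?_, ?_, ?_⟩, ?_⟩ <;> simp [run_branch, length_digitBits, *, add_assoc]

end ReadingPrograms

section RowReading

open Cmd Var

variable {n m : ℕ} {σ : Env Var} {B : ℕ → Bool} {r : RawEqn n} {R : Fin m → RawEqn n}

lemma Eqn.length_bits (e : Eqn (Fin n)) : e.bits.length = n + 1 := by
  simp [bits]

lemma toNat_decide_eq_one (x : ZMod 2) : (decide (x = 1)).toNat = x.val := by
  revert x; decide

lemma Eqn.word_eq_toNat {e : Eqn (Fin n)} {p : ℕ} (reads : Reads B p e.bits) (w : ℕ) {c : ℕ}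
    (hc : c < n + 1) : e.word w c = (B (p + c)).toNat := by
  obtain ⟨coeffs, rhs⟩ := reads_eqnBits.mp reads
  rcases Nat.lt_succ_iff_lt_or_eq.mp hc with h | rfl
  · rw [word, dif_pos h, ← toNat_decide_eq_one, ← coeffs ⟨c, h⟩]
  · rw [word, dif_neg (lt_irrefl c), if_pos rfl, rhs, toNat_decide_eq_one]

lemma readCells_run (h : HoldsBits σ B) (hp : 0 < σ.val next) (hrow : σ.val io ≤ σ.val row) :
    (readCells.run σ).mem =
        fill σ.mem (σ.val row) (σ.val cols) (fun c => (B (σ.val next + c)).toNat) ∧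
      (readCells.run σ).val next = σ.val next + σ.val cols := by
  refine run_forTo_induction (I := fun j τ => τ.mem =
    fill σ.mem (σ.val row) j (fun c => (B (σ.val next + c)).toNat) ∧
      τ.val next = σ.val next + j) (by decide) (by decide) (by simp [fill_zero])
    fun j _ τ val_c frame ⟨mem_eq, val_next⟩ => ?_
  have hB : HoldsBits τ B := h.congr (frame _ (by decide)) fun p hp => by
    rw [mem_eq, fill_of_lt _ _ (by omega)]
  have val_row : τ.val row = σ.val row := frame _ (by decide)
  rw [run_seq, readBit_run hB (by omega), val_next, fill_succ]
  simp [val_c, val_row, mem_eq, add_assoc]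

lemma readWeightedCells_run (h : HoldsBits σ B) (hp : 0 < σ.val next)
    (hrow : σ.val io ≤ σ.val row) (val_cols : σ.val cols = n + 1)
    (reads : Reads B (σ.val next) r.bits) :
    (∀ q < σ.val row, (readWeightedCells.run σ).mem q = σ.mem q) ∧
      HoldsRow (readWeightedCells.run σ).mem (σ.val row) r.1 r.weight ∧
      (readWeightedCells.run σ).val next = σ.val next + r.bits.length ∧
      (readWeightedCells.run σ).val canonical = (r.2.getLastD false).toNat := by
  obtain ⟨reads_eqn, reads_digits⟩ := reads_append.mp reads
  obtain ⟨mem_eq, val_next⟩ := readCells_run h hp hrow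
  have hB : HoldsBits (readCells.run σ) B := h.congr (run_val (by decide)) fun q hq => by
    rw [mem_eq, fill_of_lt _ _ (by omega)]
  rw [val_cols] at mem_eq val_next
  rw [r.1.length_bits, ← val_next] at reads_digits
  obtain ⟨read, val_next'⟩ := readWeight_run hB (by omega) reads_digits
  have val_row : (readWeight.run (readCells.run σ)).val row = σ.val row := by
    rw [run_val (by decide), run_val (by decide)]
  have val_cols' : (readWeight.run (readCells.run σ)).val cols = n + 1 := by
    rw [run_val (by decide), run_val (by decide), val_cols]
  have run_eq : readWeightedCells.run σ =
      (readWeight.run (readCells.run σ)).put (σ.val row + (n + 1)) r.weight := by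
    simp only [readWeightedCells, run_seq, run_store, Expr.eval_add, Expr.eval_var, val_row,
      val_cols', read.val_weight, RawEqn.weight]
  rw [run_eq]
  simp only [Env.mem_put, Env.val_put, run_mem (c := readWeight) rfl, mem_eq]
  refine ⟨fun q hq => ?_, fun c hc => ?_, ?_, read.val_canonical⟩
  · rw [Function.update_of_ne (by omega), fill_of_lt _ _ hq]
  · rcases Nat.lt_succ_iff_lt_or_eq.mp hc with hlt | rfl
    · rw [Function.update_of_ne (by omega), fill_add _ _ hlt, Eqn.word_eq_toNat reads_eqn _ hlt]
    · rw [Function.update_self, Eqn.word_weight]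
  · rw [val_next', val_next, RawEqn.bits, List.length_append, Eqn.length_bits, add_assoc]

lemma checkRow_valid (val_n : σ.val Var.n = n) {v : ℕ}
    (row : HoldsRow σ.mem (σ.val row) r.1 v)
    (val_canonical : σ.val canonical = (r.2.getLastD false).toNat) :
    0 < (checkRow.run σ).val valid ↔ 0 < σ.val valid ∧ r.Valid := by
  have isLast := findLast_isLast Var.row (by decide) val_n row
  have canonical_eq : ((findLast .row).run σ).val canonical = (r.2.getLastD false).toNat :=
    (run_val (by decide)).trans val_canonical
  have valid_eq : ((findLast .row).run σ).val valid = σ.val valid := run_val (by decide)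
  have last_pos : 0 < ((findLast .row).run σ).val last ↔ r.1.1 ≠ 0 :=
    Nat.pos_iff_ne_zero.trans isLast.eq_zero_iff.not
  simp only [checkRow, run_seq, run_branch, Expr.eval_var, canonical_eq, last_pos, RawEqn.Valid]
  cases r.2.getLastD false <;> by_cases h : r.1.1 = 0 <;> simp [h, valid_eq]

lemma readRow_run (h : HoldsBits σ B) (hp : 0 < σ.val next) (hrow : σ.val io ≤ σ.val row)
    (val_n : σ.val Var.n = n) (val_cols : σ.val cols = n + 1)
    (reads : Reads B (σ.val next) r.bits) :
    (∀ q < σ.val row, (readRow.run σ).mem q = σ.mem q) ∧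
      HoldsRow (readRow.run σ).mem (σ.val row) r.1 r.weight ∧
      (readRow.run σ).val next = σ.val next + r.bits.length ∧
      (0 < (readRow.run σ).val valid ↔ 0 < σ.val valid ∧ r.Valid) := by
  obtain ⟨before, holdsRow, val_next, val_canonical⟩ :=
    readWeightedCells_run h hp hrow val_cols reads
  have val_row : (readWeightedCells.run σ).val row = σ.val row := run_val (by decide)
  have val_n' : (readWeightedCells.run σ).val Var.n = n := (run_val (by decide)).trans val_n
  have val_valid : (readWeightedCells.run σ).val valid = σ.val valid := run_val (by decide)
  rw [readRow, run_seq, checkRow_valid val_n' (val_row ▸ holdsRow) val_canonical, val_valid,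
    run_mem (c := checkRow) rfl, run_val (c := checkRow) (by decide)]
  exact ⟨before, holdsRow, val_next, .rfl⟩

/-- The rows before the row `i` have been read. -/
structure HasReadRows (R : Fin m → RawEqn n) (B : ℕ → Bool) (p i : ℕ) (σ : Env Var) : Prop where
  bits : HoldsBits σ B
  val_next : σ.val next = p + ((List.ofFn fun j => (R j).bits).take i).flatten.length
  holdsRow : ∀ j : Fin m, j < i →
    HoldsRow σ.mem (σ.val work + j * (n + 2)) (R j).1 (R j).weight
  valid_iff : 0 < σ.val valid ↔ ∀ j : Fin m, j < i → (R j).Valid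

lemma HasReadRows.set {p i : ℕ} (h : HasReadRows R B p i σ) {x : Var}
    (hx : x ∉ [io, next, work, valid]) (a : ℕ) : HasReadRows R B p i (σ.set x a) := by
  simp only [List.mem_cons, List.not_mem_nil, or_false, not_or] at hx
  obtain ⟨hio, hnext, hwork, hvalid⟩ := hx
  obtain ⟨bits, val_next, holdsRow, valid_iff⟩ := h
  exact ⟨by simp [*], by simp [*, Ne.symm], by simpa [Ne.symm hwork] using holdsRow,
    by simp [*, Ne.symm]⟩

lemma HasReadRows.readRow_run {p i : ℕ} (h : HasReadRows R B p i σ) (hi : i < m) (hp : 0 < p)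
    (reads : Reads B p (List.ofFn fun j => (R j).bits).flatten)
    (val_row : σ.val row = σ.val work + i * (n + 2)) (hwork : σ.val io ≤ σ.val work)
    (val_n : σ.val Var.n = n) (val_cols : σ.val cols = n + 1) :
    HasReadRows R B p (i + 1) (readRow.run σ) := by
  have reads_row := reads.flatten (i := i) (by simpa)
  rw [← h.val_next, List.getElem_ofFn] at reads_row
  have next_pos : 0 < σ.val next := by
    rw [h.val_next]
    omega
  obtain ⟨before, holdsRow, val_next, valid_iff⟩ := MaxLin.readRow_run h.bits next_pos (by omega)
    val_n val_cols reads_row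
  have val_work : (readRow.run σ).val work = σ.val work := run_val (by decide)
  refine ⟨h.bits.congr (run_val (by decide)) fun q hq => before q (by omega), ?_,
    fun j hj => ?_, ?_⟩
  · rw [val_next, h.val_next, List.take_succ_eq_append_getElem (by simpa), List.flatten_append,
      List.length_append, List.getElem_ofFn, List.flatten_singleton, add_assoc]
  · rw [val_work]
    rcases Nat.lt_succ_iff_lt_or_eq.mp hj with hlt | heq
    · have := row_end_le hlt n
      exact (h.holdsRow j hlt).congr fun c hc => before _ (by omega)
    · obtain rfl : j = ⟨i, hi⟩ := Fin.ext heq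
      rwa [← val_row]
  · rw [valid_iff, h.valid_iff]
    simp only [Nat.lt_succ_iff_lt_or_eq, or_imp, forall_and]
    refine and_congr_right fun _ => ⟨fun hv j hj => ?_, fun hv => hv ⟨i, hi⟩ rfl⟩
    rwa [show j = ⟨i, hi⟩ from Fin.ext hj]

lemma readRows_run (h : HoldsBits σ B) (hp : 0 < σ.val next) (val_work : σ.val work = σ.val io)
    (val_n : σ.val Var.n = n) (val_m : σ.val Var.m = m) (val_cols : σ.val cols = n + 1)
    (val_width : σ.val width = n + 2) (hvalid : 0 < σ.val valid)
    (reads : Reads B (σ.val next) (List.ofFn fun j => (R j).bits).flatten) :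
    HasReadRows R B (σ.val next) m ((forRows readRow).run σ) := by
  have start : HasReadRows R B (σ.val next) 0 σ :=
    ⟨h, by simp, fun _ hj => absurd hj (Nat.not_lt_zero _), by simp [hvalid]⟩
  have inv := run_forRows_induction (σ := σ) (body := readRow)
    (I := HasReadRows R B (σ.val next)) (by decide)
    ((start.set (by decide) _).set (by decide) _) fun i hi τ _ val_row frame inv => ?_
  · rwa [val_m] at inv
  have val_work' : τ.val work = σ.val work := frame _ (by decide)
  have val_io : τ.val io = σ.val io := frame _ (by decide)
  have next_inv := inv.readRow_run (val_m ▸ hi) hp reads (by rw [val_row, val_work', val_width])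
    (by omega) ((frame _ (by decide)).trans val_n) ((frame _ (by decide)).trans val_cols)
  exact (next_inv.set (by decide) _).set (by decide) _

end RowReading

section BitsProgram

open Cmd Var

local notation "mem[" e "]" => (Expr.deref e : Expr Var)

/-- Read the parameter and the numbers of variables and equations. -/
def readSizes : Cmd Var :=
  k ≔ mem[0] ;; next ≔ 1 ;; readUnary n ;; readUnary m

/-- Read the sizes and prepare for the table, which is stored behind the input. -/
def readHeader : Cmd Var :=
  readSizes ;; cols ≔ n + 1 ;; width ≔ n + 2 ;; src ≔ io ;; work ≔ io ;; valid ≔ 1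

/-- Read the whole system into a table. -/
def readTable : Cmd Var :=
  readHeader ;; forRows readRow

/-- Search for a good assignment if the input has been read exactly to its end and found valid. -/
def searchIfValid : Cmd Var :=
  branch (differ next io) (valid ≔ 0) skip ;; branch valid search (io ≔ 0)

/-- Solve Max Lin AA for systems encoded as bit strings. -/
def solveBits : Cmd Var :=
  readTable ;; searchIfValid

variable {σ : Env Var} {B : ℕ → Bool} {n m : ℕ} {R : Fin m → RawEqn n}

lemma readSizes_run (h : HoldsBits σ B) (reads : Reads B 1 (unaryBits n ++ unaryBits m)) :
    (readSizes.run σ).val Var.k = σ.mem 0 ∧ (readSizes.run σ).val Var.n = n ∧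
      (readSizes.run σ).val Var.m = m ∧
      (readSizes.run σ).val next = 1 + (unaryBits n ++ unaryBits m).length := by
  obtain ⟨reads_n, reads_m⟩ := reads_append.mp reads
  set ρ := (σ.set Var.k (σ.mem 0)).set next 1
  have hB : HoldsBits ρ B := by simp [ρ, h]
  have ρ_next : ρ.val next = 1 := by simp [ρ]
  have ρ_k : ρ.val Var.k = σ.mem 0 := by simp [ρ]
  have run_eq : readSizes.run σ = (readUnary Var.m).run ((readUnary Var.n).run ρ) := rfl
  obtain ⟨val_n, next_n⟩ := readUnary_run (a := Var.n) (by decide) hB (by omega) (ρ_next ▸ reads_n)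
  rw [ρ_next] at next_n
  obtain ⟨val_m, next_m⟩ := readUnary_run (a := Var.m) (by decide)
    (hB.run (c := readUnary Var.n) (by decide) rfl) (by omega) (next_n ▸ reads_m)
  rw [run_eq, val_m, next_m, next_n, List.length_append, add_assoc]
  refine ⟨?_, ?_, rfl, rfl⟩
  · rw [run_val (by decide), run_val (by decide), ρ_k]
  · rw [run_val (by decide), val_n]

/-- The values of the variables after the header has been read. -/
structure HasReadHeader (n m k p : ℕ) (σ : Env Var) : Prop where
  val_n : σ.val Var.n = n
  val_m : σ.val Var.m = m
  val_k : σ.val Var.k = k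
  val_next : σ.val next = p
  val_cols : σ.val cols = n + 1
  val_width : σ.val width = n + 2
  val_src : σ.val src = σ.val io
  val_work : σ.val work = σ.val io
  valid_pos : 0 < σ.val valid

lemma readHeader_run (h : HoldsBits σ B) (reads : Reads B 1 (unaryBits n ++ unaryBits m)) :
    HasReadHeader n m (σ.mem 0) (1 + (unaryBits n ++ unaryBits m).length)
      (readHeader.run σ) := by
  obtain ⟨val_k, val_n, val_m, val_next⟩ := readSizes_run h reads
  constructor <;> simp [readHeader, *]

lemma readTable_run (h : HoldsBits σ B) (reads : Reads B 1 (rawBits R)) :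
    (readTable.run σ).val Var.n = n ∧ (readTable.run σ).val Var.m = m ∧
      (readTable.run σ).val Var.k = σ.mem 0 ∧
      (readTable.run σ).val src = (readTable.run σ).val work ∧
      HasReadRows R B (1 + (unaryBits n ++ unaryBits m).length) m (readTable.run σ) := by
  obtain ⟨reads_sizes, reads_rows⟩ := reads_append.mp reads
  have header := readHeader_run h reads_sizes
  have unchanged (x) (hx : x ∉ (forRows readRow).writes) :
      (readTable.run σ).val x = (readHeader.run σ).val x := run_val hx
  rw [unchanged _ (by decide), unchanged _ (by decide), unchanged _ (by decide),
    unchanged _ (by decide), unchanged _ (by decide), ← header.val_next]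
  refine ⟨header.val_n, header.val_m, header.val_k, header.val_src.trans header.val_work.symm, ?_⟩
  exact readRows_run (h.run (by decide) rfl) (by rw [header.val_next]; omega) header.val_work
    header.val_n header.val_m header.val_cols header.val_width header.valid_pos
    (header.val_next ▸ reads_rows)

lemma searchIfValid_io_pos_iff : 0 < (searchIfValid.run σ).val io ↔
    σ.val next = σ.val io ∧ 0 < σ.val valid ∧ 0 < (search.run σ).val io := by
  simp only [searchIfValid, run_seq, run_branch, differ_pos_iff, Expr.eval_var]
  by_cases hnext : σ.val next = σ.val io <;> by_cases hvalid : 0 < σ.val valid <;>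
    simp [hnext, hvalid]

end BitsProgram

section BitsCorrect

open Cmd

variable {n m : ℕ} {R : Fin m → RawEqn n}

/-- The bits of `x`, numbered from `1` on. -/
def bitStream (x : List Bool) (p : ℕ) : Bool := (false :: x).getD p false

lemma reads_bitStream (x : List Bool) : Reads (bitStream x) 1 x := fun i hi => by
  simp [bitStream, add_comm 1, hi]

lemma bitStream_of_length_lt {x : List Bool} {p : ℕ} (hp : x.length + 1 ≤ p) :
    bitStream x p = false := List.getD_eq_default _ _ (by simpa)

/-- The environment at the start for the input `(x, k)`. -/
def bitsStart (x : List Bool) (k : ℕ) : Env Var := Env.start (k :: x.map Bool.toNat)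

lemma bitsStart_io (x : List Bool) (k : ℕ) : (bitsStart x k).val .io = x.length + 1 := by
  simp [bitsStart, Env.start]

lemma holdsBits_bitsStart (x : List Bool) (k : ℕ) : HoldsBits (bitsStart x k) (bitStream x) where
  io_pos := by simp [bitsStart_io]
  mem p hp hlt := by
    obtain ⟨p, rfl⟩ := Nat.exists_eq_add_one.mpr hp
    have hp' : p < x.length := by simpa [bitsStart_io] using hlt
    simp [bitsStart, Env.start, bitStream, hp']
  beyond p hle := bitStream_of_length_lt (bitsStart_io x k ▸ hle)

lemma solveBits_answer_of_reads {x : List Bool} {k : ℕ}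
    (reads : Reads (bitStream x) 1 (rawBits R)) :
    0 < (solveBits.run (bitsStart x k)).val .io ↔
      (rawBits R).length = x.length ∧ ∃ S : System n m, S.raw = R ∧ (k : ℤ) ≤ S.maxExcess := by
  obtain ⟨val_n, val_m, val_k, val_src, rows⟩ := readTable_run (holdsBits_bitsStart x k) reads
  have val_io : (readTable.run (bitsStart x k)).val .io = x.length + 1 :=
    (run_val (by decide)).trans (bitsStart_io x k)
  have answer (S : System n m) (hS : S.raw = R) :
      0 < (search.run (readTable.run (bitsStart x k))).val .io ↔ (k : ℤ) ≤ S.maxExcess := by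
    subst hS
    refine search_answer S val_n val_m (val_k.trans ?_) fun j => ?_
    · simp [bitsStart, Env.start]
    · rw [val_src, ← S.raw_weight]
      exact rows.holdsRow j j.2
  have read_all : (readTable.run (bitsStart x k)).val .next =
      (readTable.run (bitsStart x k)).val .io ↔ (rawBits R).length = x.length := by
    rw [rows.val_next, List.take_of_length_le (by simp), val_io]
    simp only [rawBits, List.length_append]
    omega
  rw [solveBits, run_seq, searchIfValid_io_pos_iff, read_all, rows.valid_iff]
  refine and_congr_right fun _ => ⟨fun ⟨valid, found⟩ => ?_, fun ⟨S, hS, hk⟩ => ?_⟩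
  · obtain ⟨S, hS⟩ := exists_system_raw_eq fun j => valid j j.2
    exact ⟨S, hS, (answer S hS).mp found⟩
  · exact ⟨fun j _ => hS ▸ S.raw_valid j, (answer S hS).mpr hk⟩

theorem solveBits_answer (x : List Bool) (k : ℕ) :
    0 < (solveBits.run (bitsStart x k)).val .io ↔ (x, k) ∈ maxLinAA := by
  constructor
  · intro accepts
    obtain ⟨n, m, R, reads⟩ := exists_reads_rawBits
      (L := x.length + 1) (fun p hp => bitStream_of_length_lt hp) 1
    obtain ⟨length_eq, S, rfl, hk⟩ := (solveBits_answer_of_reads reads).mp accepts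
    refine ⟨n, m, S, ?_, hk⟩
    rw [S.toBits_eq_rawBits]
    exact List.ext_getElem length_eq.symm fun i h h' =>
      (reads_bitStream x i h).symm.trans (reads i h')
  · rintro ⟨n, m, S, rfl : x = S.toBits, hk⟩
    exact (solveBits_answer_of_reads (S.toBits_eq_rawBits ▸ reads_bitStream _)).mpr
      ⟨by rw [S.toBits_eq_rawBits], S, rfl, hk⟩

end BitsCorrect

section BitsTime

open Cmd

variable {σ : Env Var} {n m k : ℕ} {x : List Bool}

lemma searchIfValid_time_le (val_n : σ.val .n = n) (val_m : σ.val .m = m)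
    (val_k : σ.val .k = k) : searchIfValid.time σ ≤
      searchIfValid.cost * (m ^ min k m * searchSize n m ^ search.depth) := by
  set check := branch (differ Var.next Var.io) (.valid ≔ 0) skip
  have time_search := search_time_le (σ := check.run σ) ((run_val (by decide)).trans val_n)
    ((run_val (by decide)).trans val_m) ((run_val (by decide)).trans val_k)
  have time_check : check.time σ ≤ check.cost * (0 + 1) ^ 0 := time_le (by decide) nofun
  have time_decide : (branch (Var.valid : Expr Var) search (.io ≔ 0)).time (check.run σ) ≤
      4 + search.time (check.run σ) := by
    rw [time]
    split_ifs
    · simp [Expr.cost]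
    · simp [Expr.cost, time]
  have cost_eq : searchIfValid.cost = check.cost + (2 + (search.cost + 2)) := rfl
  have one_le := Nat.mul_pos (one_le_pow_min m k) (one_le_searchSize_pow n m search.depth)
  rw [searchIfValid, time_seq, ← searchIfValid, cost_eq]
  nlinarith

lemma sizes_le {R : Fin m → RawEqn n} (reads : Reads (bitStream x) 1 (rawBits R)) :
    n ≤ x.length ∧ m ≤ x.length := by
  obtain ⟨reads_sizes, -⟩ := reads_append.mp reads
  obtain ⟨reads_n, reads_m⟩ := reads_append.mp reads_sizes
  have hB := holdsBits_bitsStart x 0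
  have hn := hB.unary_lt_io Nat.one_pos reads_n
  have hm := hB.unary_lt_io (by omega) reads_m
  rw [bitsStart_io] at hn hm
  exact ⟨Nat.le_of_lt_succ hn, Nat.le_of_lt_succ hm⟩

lemma readHeader_time_le (x : List Bool) (k : ℕ) : readHeader.time (bitsStart x k) ≤
    readHeader.cost * (x.length + 2) ^ readHeader.depth :=
  time_le (by decide) fun y hy => by
    obtain rfl : y = .io := by revert y; decide
    exact (bitsStart_io x k).le

lemma readRows_time_le {R : Fin m → RawEqn n} (reads : Reads (bitStream x) 1 (rawBits R)) :
    (forRows readRow).time (readHeader.run (bitsStart x k)) ≤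
      (forRows readRow).cost * (x.length + 2) ^ (forRows readRow).depth := by
  have header := readHeader_run (holdsBits_bitsStart x k) (reads_append.mp reads).1
  have val_io : (readHeader.run (bitsStart x k)).val .io = x.length + 1 :=
    (run_val (by decide)).trans (bitsStart_io x k)
  obtain ⟨hn, hm⟩ := sizes_le reads
  have bounds_subset : (forRows readRow).bounds ⊆ [.n, .m, .cols, .io] := by decide
  refine time_le (B := x.length + 1) (by decide) fun y hy => ?_
  have hy := bounds_subset hy
  simp only [List.mem_cons, List.not_mem_nil, or_false] at hy
  rcases hy with rfl | rfl | rfl | rfl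
  · rw [header.val_n]; omega
  · rw [header.val_m]; omega
  · rw [header.val_cols]; omega
  · exact val_io.le

lemma pow_mul_searchSize_pow_le {L : ℕ} (hn : n ≤ L) (hm : m ≤ L) (k d : ℕ) :
    m ^ min k m * searchSize n m ^ d ≤ (L + 2) ^ (k + 2 * d) := by
  have size : searchSize n m ≤ (L + 2) ^ 2 := by
    unfold searchSize
    nlinarith
  calc m ^ min k m * searchSize n m ^ d ≤ (L + 2) ^ min k m * ((L + 2) ^ 2) ^ d := by
        gcongr
        omega
    _ = (L + 2) ^ (min k m + 2 * d) := by rw [← pow_mul, pow_add]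
    _ ≤ (L + 2) ^ (k + 2 * d) := by
      gcongr <;> omega

/-- The exponent of the running time of `solveBits`, apart from the parameter. -/
def bitsExponent : ℕ := readHeader.depth + (forRows readRow).depth + 2 * search.depth

lemma solveBits_time_le (x : List Bool) (k : ℕ) : solveBits.time (bitsStart x k) ≤
    solveBits.cost * (x.length + 2) ^ (k + bitsExponent) := by
  obtain ⟨n, m, R, reads⟩ := exists_reads_rawBits
    (L := x.length + 1) (fun p hp => bitStream_of_length_lt hp) 1
  obtain ⟨val_n, val_m, val_k, -, -⟩ := readTable_run (holdsBits_bitsStart x k) reads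
  obtain ⟨hn, hm⟩ := sizes_le reads
  calc _ = readHeader.time (bitsStart x k) +
          (forRows readRow).time (readHeader.run (bitsStart x k)) +
          searchIfValid.time (readTable.run (bitsStart x k)) := rfl
    _ ≤ _ := Nat.add_le_add (Nat.add_le_add (readHeader_time_le x k) (readRows_time_le reads))
          ((searchIfValid_time_le (k := k) val_n val_m val_k).trans
            (Nat.mul_le_mul_left _ (pow_mul_searchSize_pow_le hn hm _ _)))
    _ ≤ readHeader.cost * (x.length + 2) ^ (k + bitsExponent) +
          (forRows readRow).cost * (x.length + 2) ^ (k + bitsExponent) +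
          searchIfValid.cost * (x.length + 2) ^ (k + bitsExponent) := by
      unfold bitsExponent
      gcongr <;> omega
    _ = solveBits.cost * (x.length + 2) ^ (k + bitsExponent) := by
      rw [← add_mul, ← add_mul]; rfl

theorem inXP_maxLinAA : InXP maxLinAA := by
  set a := bitsExponent + solveBits.cost
  refine ⟨solveBits.code Var.ctorIdx 0, fun k => k + a,
    (Primrec.nat_add.comp .id (.const a)).to_comp, fun x k =>
      ⟨_, solveBits.answers (solveBits_answer x k), ?_⟩⟩
  have cost_le : solveBits.cost ≤ (x.length + 2) ^ solveBits.cost :=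
    Nat.lt_two_pow_self.le.trans (Nat.pow_le_pow_left (by omega) _)
  calc _ ≤ solveBits.cost * (x.length + 2) ^ (k + bitsExponent) := solveBits_time_le x k
    _ ≤ (x.length + 2) ^ solveBits.cost * (x.length + 2) ^ (k + bitsExponent) := by gcongr
    _ = (x.length + 2) ^ (k + a) := by
      rw [← pow_add]
      congr 1
      omega

end BitsTime

end MaxLin

theorem mainTheorem7 :
    (∃ (P : MaxLin.Prog) (C c : ℕ), ∀ (n m k : ℕ) (S : MaxLin.System n m), ∃ t : ℕ,
      P.Answers (k :: S.toWords) t ((k : ℤ) ≤ S.maxExcess) ∧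
      (0 < m → t ≤ C * (n ^ c * m ^ (k + c))) ∧
      (0 < m → n ≤ m → t ≤ C * m ^ (k + c))) ∧
    MaxLin.InXP MaxLin.maxLinAA :=
  ⟨MaxLin.exists_prog_toWords, MaxLin.inXP_maxLinAA⟩
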